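/- Let $\sigma_x,\sigma_y,\sigma_z$ be the Pauli matrices and $R_n(\theta)=e^{-i\theta\sigma_n/2}$ for $n\in\{x,y,z\}$, $\theta\in\mathbb R$. For $S\subseteq\{x,y,z\}$, a two-qubit circuit over the library $\{\mathrm{CNOT}\}\cup\{R_n:n\in S\}$ is a finite sequence of gates, each of which is a CNOT (with either orientation) or a rotation $R_n(\theta)$, $n\in S$, on one of the two wires. A circuit simulates $U\in SU(4)$ if the product of its gates equals $U$ up to a global phase. A circuit topology is a circuit in which the rotation angles are left unspecified; it is universal if every $U\in SU(4)$ is simulated by the circuit obtained from it by some choice of the angles. Say that a circuit or a circuit topology has property $(\ast)$ if all but at most three of its rotation gates lie before the first or after the last CNOT. Then: 1. For almost all $U\in SU(4)$ (with respect to Haar measure), no two-qubit circuit over $\{\mathrm{CNOT},R_x,R_z\}$ (the CXZ library) with property $(\ast)$ simulates $U$. 2. In contrast, over $\{\mathrm{CNOT},R_y,R_z\}$ (the CYZ library), and likewise over $\{\mathrm{CNOT},R_x,R_y\}$ (the CXY library), there is a universal two-qubit circuit topology with property $(\ast)$. -/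

import Mathlib

open MeasureTheory
open scoped Kronecker

namespace TwoQubit

/-- Operators on two qubits: complex matrices indexed by the computational basis `|a b⟩`. -/
abbrev Op : Type := Matrix (Fin 2 × Fin 2) (Fin 2 × Fin 2) ℂ

/-- `SU(4)`, acting on the state space of two qubits. -/
abbrev SU4 : Type := Matrix.specialUnitaryGroup (Fin 2 × Fin 2) ℂ

instance : IsTopologicalGroup SU4 where
  continuous_inv := by
    refine continuous_induced_rng.mpr ?_
    exact continuous_star.comp continuous_subtype_val

instance : CompactSpace SU4 := by
  refine isCompact_iff_compactSpace.mp ?_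
  have hc : IsClosed (Matrix.specialUnitaryGroup (Fin 2 × Fin 2) ℂ : Set Op) := by
    have h : (Matrix.specialUnitaryGroup (Fin 2 × Fin 2) ℂ : Set Op) =
        (unitary Op : Set Op) ∩ {A | A.det = 1} := rfl
    rw [h]
    exact isClosed_unitary.inter
      (isClosed_eq (Continuous.matrix_det continuous_id) continuous_const)
  have hb : IsCompact (Set.pi Set.univ fun _ : Fin 2 × Fin 2 =>
      Set.pi Set.univ fun _ : Fin 2 × Fin 2 => Metric.closedBall (0 : ℂ) 1) :=
    isCompact_univ_pi fun _ => isCompact_univ_pi fun _ => isCompact_closedBall 0 1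
  refine hb.of_isClosed_subset hc ?_
  intro A hA i _ j _
  rw [mem_closedBall_zero_iff]
  exact entry_norm_bound_of_unitary hA.1 i j

noncomputable instance : MeasurableSpace SU4 := borel SU4

instance : BorelSpace SU4 := ⟨rfl⟩

/-- Haar measure on `SU(4)`. -/
noncomputable def haarSU4 : Measure SU4 := Measure.haar

/-- The coordinate axes of the Bloch sphere. -/
inductive Axis
  | x
  | y
  | z

/-- The Pauli matrices. -/
noncomputable def pauli : Axis → Matrix (Fin 2) (Fin 2) ℂ
  | .x => !![0, 1; 1, 0]
  | .y => !![0, -Complex.I; Complex.I, 0]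
  | .z => !![1, 0; 0, -1]

/-- The rotation `R_n(θ) = exp(-i θ σ_n / 2) = cos(θ/2) - i sin(θ/2) σ_n`. -/
noncomputable def rotation (n : Axis) (θ : ℝ) : Matrix (Fin 2) (Fin 2) ℂ :=
  (Real.cos (θ / 2) : ℂ) • 1 - (Complex.I * (Real.sin (θ / 2) : ℂ)) • pauli n

/-- A one-qubit operator acting on the given wire (wire `0` is the first tensor factor). -/
noncomputable def onWire (w : Fin 2) (A : Matrix (Fin 2) (Fin 2) ℂ) : Op :=
  if w = 0 then A ⊗ₖ 1 else 1 ⊗ₖ A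

/-- The controlled-not gate with control on the given wire and target on the other one:
`|a b⟩ ↦ |a, a ⊕ b⟩` or `|a b⟩ ↦ |a ⊕ b, b⟩` (addition in `Fin 2` is XOR). Its determinant is `-1`;
the scalar that would normalize it into `SU(4)` is irrelevant, because simulation is understood
up to a global phase. -/
noncomputable def cnot (control : Fin 2) : Op :=
  Matrix.of fun i j =>
    if i = (if control = 0 then (j.1, j.1 + j.2) else (j.1 + j.2, j.2)) then 1 else 0

/-- A fully specified elementary gate. -/
inductive Gate
  | cnot (control : Fin 2)
  | rot (n : Axis) (wire : Fin 2) (θ : ℝ)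

/-- A gate whose angle, if it has one, is left unspecified. -/
inductive Placeholder
  | cnot (control : Fin 2)
  | rot (n : Axis) (wire : Fin 2)

/-- A two-qubit circuit: a finite sequence of gates, listed in the order of application. -/
abbrev Circuit : Type := List Gate

/-- A two-qubit circuit topology: a circuit with unspecified rotation angles. -/
abbrev Topology : Type := List Placeholder

/-- The operator of a gate. -/
noncomputable def Gate.op : Gate → Op
  | .cnot c => TwoQubit.cnot c
  | .rot n w θ => onWire w (rotation n θ)

/-- The operator of a circuit; the head of the list is applied first. -/
noncomputable def Circuit.op : Circuit → Op
  | [] => 1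
  | g :: C => Circuit.op C * g.op

/-- The circuit `C` simulates `U`, up to global phase. -/
def Circuit.Simulates (C : Circuit) (U : SU4) : Prop :=
  ∃ ζ : ℂ, ‖ζ‖ = 1 ∧ (U : Op) = ζ • Circuit.op C

/-- Forget the angle of a gate. -/
def Gate.placeholder : Gate → Placeholder
  | .cnot c => .cnot c
  | .rot n w _ => .rot n w

/-- The topology to which a circuit conforms. -/
def Circuit.topology (C : Circuit) : Topology := C.map Gate.placeholder

/-- `Q(T)`: the operators simulated, up to global phase, by circuits conforming to `T`. -/
def Topology.Q (T : Topology) : Set SU4 :=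
  {U | ∃ C : Circuit, C.topology = T ∧ C.Simulates U}

/-- A topology is universal if its circuits simulate all of `SU(4)`. -/
def Topology.IsUniversal (T : Topology) : Prop := T.Q = Set.univ

/-- All gates of `T` are from the library consisting of CNOT and `R_n` for `n ∈ S`. -/
def Topology.InLibrary (T : Topology) (S : Set Axis) : Prop :=
  ∀ n w, Placeholder.rot n w ∈ T → n ∈ S

/-- Is this placeholder a one-qubit gate? -/
def Placeholder.isRot : Placeholder → Bool
  | .cnot _ => false
  | .rot _ _ => true

/-- All but at most `k` of the one-qubit gates of `T` lie before the first or after the last CNOT: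
`T` consists of an initial and a final part without CNOTs and a middle part with at most `k`
one-qubit gates (and any number of CNOTs). -/
def Topology.AllButOutside (T : Topology) (k : ℕ) : Prop :=
  ∃ before middle after : Topology, T = before ++ middle ++ after ∧
    (∀ p ∈ before, p.isRot) ∧ (∀ p ∈ after, p.isRot) ∧
    middle.countP Placeholder.isRot ≤ k

end TwoQubit

/-! Both halves rest on the bilinear form S = σ_y ⊗ σ_y (`spinFlip`). Since A σ_y Aᵀ = det(A) σ_y
for 2 × 2 matrices, operators A ⊗ B with factors of determinant 1 preserve S; conversely a special
unitary preserving S is such a product (`exists_local`). Hence f(M) = tr(M S Mᵀ S) (`flipTrace`)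
does not change when M is multiplied by one-qubit rotations on either side.

Obstruction for CXZ. Conjugation by a CNOT permutes the strings made of σ_x only, and those made of
σ_z only. All CNOTs of the middle part can therefore be moved to one side, leaving K G with K a
product of at most three rotations generated by such pure strings (`exists_normal_form`). Pure
strings are real matrices, so complex conjugation reverses the angle of these rotations, and so does
conjugation by a Pauli string anticommuting with the generator. A string anticommuting with all
three generators identifies f with its complex conjugate up to sign, so f² is real. Such a string is
missing only when the three generators multiply to the identity; then one of them is local, can be
brought to the outer end and dropped (`exists_common_pairing`). A phase relating a circuit to an
element of SU(4) has fourth power ±1, so f(U)² is still real.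

This is exceptional: Im f² (`obstruction`) is analytic along one-parameter subgroups and is not
identically zero. A Fubini argument (`ae_eq_zero_on_orbit`), applied to a list of subgroups whose
products fill SU(4) up to phase, shows that its zero set is null (`ae_obstruction_ne_zero`).

Universality for CYZ. The canonical decomposition writes U as local · exp(commuting two-qubit terms)
· local. Three CNOTs with one z rotation and two y rotations between them realize the middle factor
up to a swap, and the swap is absorbed by decomposing U · swap. Hadamard conjugation exchanges x and
z and gives CXY. -/

namespace TwoQubit

open Matrix

/-! ### Simultaneous diagonalization over the reals -/

/-- Commuting symmetric operators on a real inner product space have a common orthonormal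
eigenbasis. -/
theorem exists_orthonormalBasis_of_commute {E : Type*} [NormedAddCommGroup E]
    [InnerProductSpace ℝ E] [FiniteDimensional ℝ E] {ι : Type*} [Fintype ι]
    (hι : Fintype.card ι = Module.finrank ℝ E) {A B : E →ₗ[ℝ] E} (hA : A.IsSymmetric)
    (hB : B.IsSymmetric) (hAB : Commute A B) :
    ∃ (b : OrthonormalBasis ι ℝ E) (x y : ι → ℝ),
      ∀ i, A (b i) = x i • b i ∧ B (b i) = y i • b i := by
  classical
  have hinv : ∀ μ : ℝ, ∀ v ∈ Module.End.eigenspace A μ, B v ∈ Module.End.eigenspace A μ :=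
    fun μ => Module.End.mapsTo_genEigenspace_of_comm hAB μ 1
  have hres : ∀ μ : ℝ, (B.restrict (hinv μ)).IsSymmetric := fun μ => hB.restrict_invariant (hinv μ)
  let v : ∀ μ : Module.End.Eigenvalues A,
      OrthonormalBasis (Fin (Module.finrank ℝ (Module.End.eigenspace A (μ : ℝ)))) ℝ
        (Module.End.eigenspace A (μ : ℝ)) := fun μ => (hres μ).eigenvectorBasis rfl
  let b := hA.direct_sum_isInternal.collectedOrthonormalBasis hA.orthogonalFamily_eigenspaces' v
  have hb : ∀ a, b a = (v a.1 a.2 : E) := fun a => by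
    simp [b, DirectSum.IsInternal.collectedOrthonormalBasis]
  have hcard : Fintype.card (Σ μ : Module.End.Eigenvalues A,
      Fin (Module.finrank ℝ (Module.End.eigenspace A (μ : ℝ)))) = Fintype.card ι := by
    rw [hι, Module.finrank_eq_card_basis b.toBasis]
  let e := Fintype.equivOfCardEq hcard
  refine ⟨b.reindex e, fun i => (e.symm i).1, fun i => (hres (e.symm i).1).eigenvalues rfl
    (e.symm i).2, fun i => ?_⟩
  rw [OrthonormalBasis.reindex_apply, hb]
  refine ⟨Module.End.mem_eigenspace_iff.mp (v _ _).2, ?_⟩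
  have h := (hres (e.symm i).1).apply_eigenvectorBasis rfl (e.symm i).2
  exact congrArg Subtype.val h

/-- Commuting real symmetric matrices are simultaneously diagonalized by an orthogonal matrix. -/
theorem exists_orthogonal_diagonalization {n : Type*} [Fintype n] [DecidableEq n]
    {X Y : Matrix n n ℝ} (hX : X.IsSymm) (hY : Y.IsSymm) (hXY : Commute X Y) :
    ∃ (O : Matrix n n ℝ) (x y : n → ℝ), O.transpose * O = 1 ∧
      X * O = O * Matrix.diagonal x ∧ Y * O = O * Matrix.diagonal y := by
  have hX' : (Matrix.toEuclideanLin X).IsSymmetric :=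
    Matrix.isSymmetric_toEuclideanLin_iff.mpr (by simpa [Matrix.IsHermitian] using! hX)
  have hY' : (Matrix.toEuclideanLin Y).IsSymmetric :=
    Matrix.isSymmetric_toEuclideanLin_iff.mpr (by simpa [Matrix.IsHermitian] using! hY)
  have hc : Commute (Matrix.toEuclideanLin X) (Matrix.toEuclideanLin Y) := by
    ext v i
    have := congrArg (fun Z : Matrix n n ℝ => Z.mulVec v.ofLp i) hXY.eq
    simpa [Matrix.mulVec_mulVec] using this
  obtain ⟨b, x, y, h⟩ := exists_orthonormalBasis_of_commute (ι := n) (by simp) hX' hY' hc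
  refine ⟨Matrix.of fun i j => b j i, x, y, ?_, ?_, ?_⟩
  · ext i j
    have := orthonormal_iff_ite.mp b.orthonormal i j
    simpa [Matrix.mul_apply, Matrix.one_apply, PiLp.inner_apply, mul_comm] using this
  · ext i j
    have := congrArg (fun v : EuclideanSpace ℝ n => v i) (h j).1
    simpa [Matrix.mulVec, dotProduct, Matrix.mul_apply, Matrix.diagonal_apply, mul_comm] using this
  · ext i j
    have := congrArg (fun v : EuclideanSpace ℝ n => v i) (h j).2
    simpa [Matrix.mulVec, dotProduct, Matrix.mul_apply, Matrix.diagonal_apply, mul_comm] using this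

/-! ### The spin-flip form and local operators -/

/-- The spin flip `σ_y ⊗ σ_y`, as a bilinear form on the state space. -/
noncomputable def spinFlip : Op := pauli .y ⊗ₖ pauli .y

/-- The special unitary group of one qubit. -/
abbrev SU2 := Matrix.specialUnitaryGroup (Fin 2) ℂ

theorem spinFlip_apply (i j : Fin 2 × Fin 2) :
    spinFlip i j = pauli .y i.1 j.1 * pauli .y i.2 j.2 := rfl

theorem spinFlip_mul_self : spinFlip * spinFlip = 1 := by
  have h : pauli .y * pauli .y = 1 := by
    ext i j; fin_cases i <;> fin_cases j <;> simp [pauli, Matrix.mul_apply]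
  rw [spinFlip, ← Matrix.mul_kronecker_mul, h, Matrix.one_kronecker_one]

/-- σ_y is a multiple of the alternating form on the plane, which every matrix scales by its
determinant. -/
theorem mul_pauli_y_mul_transpose (A : Matrix (Fin 2) (Fin 2) ℂ) :
    A * pauli .y * Aᵀ = A.det • pauli .y := by
  ext i j
  fin_cases i <;> fin_cases j <;>
    simp [pauli, Matrix.mul_apply, Matrix.det_fin_two, Fin.sum_univ_two] <;> ring

theorem kronecker_mul_spinFlip (A B : Matrix (Fin 2) (Fin 2) ℂ) :
    (A ⊗ₖ B) * spinFlip * (A ⊗ₖ B)ᵀ = (A.det * B.det) • spinFlip := by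
  rw [← Matrix.kroneckerMap_transpose, spinFlip, ← Matrix.mul_kronecker_mul,
    ← Matrix.mul_kronecker_mul, mul_pauli_y_mul_transpose, mul_pauli_y_mul_transpose,
    Matrix.smul_kronecker, Matrix.kronecker_smul, smul_smul]

theorem transpose_mul_spinFlip {M : Op} (h : M * spinFlip * Mᵀ = spinFlip) :
    Mᵀ * spinFlip * M = spinFlip := by
  have h1 : M * (spinFlip * Mᵀ * spinFlip) = 1 := by
    rw [← spinFlip_mul_self, ← Matrix.mul_assoc, ← Matrix.mul_assoc, h]
  have h2 := mul_eq_one_comm.mp h1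
  calc Mᵀ * spinFlip * M = spinFlip * (spinFlip * Mᵀ * spinFlip * M) := by
        simp only [← Matrix.mul_assoc, spinFlip_mul_self, Matrix.one_mul]
    _ = spinFlip := by rw [h2, Matrix.mul_one]

/-- Read as a 2 × 2 matrix, ψ is singular, hence of rank at most one. -/
theorem exists_product_of_isotropic (ψ : Fin 2 × Fin 2 → ℂ)
    (h : ψ (0, 0) * ψ (1, 1) = ψ (0, 1) * ψ (1, 0)) :
    ∃ u v : Fin 2 → ℂ, ∀ a b, ψ (a, b) = u a * v b := by
  by_cases h0 : ψ (0, 0) = 0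
  · by_cases h1 : ψ (0, 1) = 0
    · refine ⟨![0, 1], ![ψ (1, 0), ψ (1, 1)], fun a b => ?_⟩
      fin_cases a <;> fin_cases b <;> simp [h0, h1]
    · refine ⟨![1, ψ (1, 1) / ψ (0, 1)], ![0, ψ (0, 1)], fun a b => ?_⟩
      have h2 : ψ (1, 0) = 0 := by
        rw [h0, zero_mul] at h
        exact (mul_eq_zero.mp h.symm).resolve_left h1
      fin_cases a <;> fin_cases b <;> simp [h0, h1, h2]
  · refine ⟨![1, ψ (1, 0) / ψ (0, 0)], ![ψ (0, 0), ψ (0, 1)], fun a b => ?_⟩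
    fin_cases a <;> fin_cases b <;> simp [h0]
    field_simp
    linear_combination h

/-- The determinant of two vectors of the plane. -/
def area (u v : Fin 2 → ℂ) : ℂ := u 0 * v 1 - u 1 * v 0

theorem exists_smul_of_area_eq_zero {u v : Fin 2 → ℂ} (hu : u ≠ 0) (h : area u v = 0) :
    ∃ k : ℂ, v = k • u := by
  unfold area at h
  by_cases h0 : u 0 = 0
  · have h1 : u 1 ≠ 0 := fun h1 => hu (by ext i; fin_cases i <;> simp [h0, h1])
    refine ⟨v 1 / u 1, ?_⟩
    have : v 0 = 0 := by
      rw [h0, zero_mul, zero_sub, neg_eq_zero] at h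
      exact (mul_eq_zero.mp h).resolve_left h1
    ext i; fin_cases i <;> simp [h0, h1, this]
  · refine ⟨v 0 / u 0, ?_⟩
    ext i; fin_cases i <;> simp [h0]
    field_simp
    linear_combination h

/-- The values of the spin-flip form on product vectors. -/
theorem spinFlip_form_product {M : Op} (hM : Mᵀ * spinFlip * M = spinFlip) (k l : Fin 2 × Fin 2)
    {u v u' v' : Fin 2 → ℂ} (h : ∀ a b, M (a, b) k = u a * v b)
    (h' : ∀ a b, M (a, b) l = u' a * v' b) :
    area u u' * area v v' = -spinFlip k l := by
  rw [← hM]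
  simp [Matrix.mul_apply, Fintype.sum_prod_type, spinFlip_apply, Fin.sum_univ_two, h, h', pauli,
    area]
  ring

/-- The form takes the value -2 (ψ₀₀ψ₁₁ - ψ₀₁ψ₁₀) on ψ, and the diagonal of `spinFlip` vanishes; so
every column of `M` is isotropic. -/
theorem exists_product_column {M : Op} (hM : Mᵀ * spinFlip * M = spinFlip) (k : Fin 2 × Fin 2) :
    ∃ u v : Fin 2 → ℂ, ∀ a b, M (a, b) k = u a * v b := by
  refine exists_product_of_isotropic (fun i => M i k) ?_
  have h := congrFun (congrFun hM k) k
  have h0 : spinFlip k k = 0 := by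
    obtain ⟨a, b⟩ := k
    fin_cases a <;> simp [spinFlip_apply, pauli]
  rw [h0] at h
  simp [Matrix.mul_apply, Fintype.sum_prod_type, spinFlip_apply, Fin.sum_univ_two, pauli] at h
  linear_combination (-1 / 2 : ℂ) * h

/-- On product vectors the form is a product of two areas. Its prescribed values on pairs of columns
force the second factors of the last two columns to be proportional to `v` and `v'`, and their first
factors to be proportional to each other; the nonzero values then match the scalars. -/
theorem exists_kronecker_of_common_factor {M : Op} (hM : Mᵀ * spinFlip * M = spinFlip)
    {u v v' : Fin 2 → ℂ} (h00 : ∀ a b, M (a, b) (0, 0) = u a * v b)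
    (h01 : ∀ a b, M (a, b) (0, 1) = u a * v' b) :
    ∃ A B : Matrix (Fin 2) (Fin 2) ℂ, M = A ⊗ₖ B := by
  obtain ⟨x, y, h10⟩ := exists_product_column hM (1, 0)
  obtain ⟨p, q, h11⟩ := exists_product_column hM (1, 1)
  have f1 := spinFlip_form_product hM _ _ h00 h10
  have f2 := spinFlip_form_product hM _ _ h01 h10
  have f3 := spinFlip_form_product hM _ _ h00 h11
  have f4 := spinFlip_form_product hM _ _ h01 h11
  have f5 := spinFlip_form_product hM _ _ h10 h11
  simp [spinFlip_apply, pauli] at f1 f2 f3 f4 f5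
  have hv : v ≠ 0 := by rintro rfl; simp [area] at f3
  have hv' : v' ≠ 0 := by rintro rfl; simp [area] at f2
  have hux : area u x ≠ 0 := fun h => by simp [h] at f2
  have hup : area u p ≠ 0 := fun h => by simp [h] at f3
  have hvq : area v q ≠ 0 := fun h => by simp [h] at f3
  obtain ⟨m, rfl⟩ := exists_smul_of_area_eq_zero hv (f1.resolve_left hux)
  obtain ⟨k, rfl⟩ := exists_smul_of_area_eq_zero hv' (f4.resolve_left hup)
  have hm : m ≠ 0 := by rintro rfl; simp [area] at f2
  have hx : x ≠ 0 := by rintro rfl; simp [area] at hux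
  have hk : k ≠ 0 := by rintro rfl; simp [area] at f3
  have hvv : area v v' ≠ 0 := fun h => hvq (by
    simp only [area, Pi.smul_apply, smul_eq_mul] at h ⊢; linear_combination k * h)
  have hxp : area x p = 0 := by
    refine f5.resolve_right fun h => mul_ne_zero (mul_ne_zero hm hk) hvv ?_
    rw [← h]; simp only [area, Pi.smul_apply, smul_eq_mul]; ring
  obtain ⟨l, rfl⟩ := exists_smul_of_area_eq_zero hx hxp
  have hkl : k * l = m := by
    simp only [area, Pi.smul_apply, smul_eq_mul] at f2 f3 hux hvv
    refine mul_right_cancel₀ (mul_ne_zero hux hvv) ?_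
    linear_combination f3 + f2
  refine ⟨Matrix.of fun a c => ![u a, m * x a] c, Matrix.of fun b d => ![v b, v' b] d, ?_⟩
  ext ⟨a, b⟩ ⟨c, d⟩
  fin_cases c <;> fin_cases d <;> simp [h00, h01, h10, h11]
  · ring
  · rw [← hkl]; ring

/-- The exchange of the two qubits. -/
def swap : Op := Matrix.of fun i j => if i = j.swap then 1 else 0

theorem swap_mul_apply (M : Op) (i j : Fin 2 × Fin 2) : (swap * M) i j = M i.swap j := by
  simp only [swap, Matrix.mul_apply, Matrix.of_apply, ite_mul, one_mul, zero_mul]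
  rw [Finset.sum_eq_single i.swap]
  · simp
  · intro b _ hb
    rw [if_neg fun h => hb (by rw [h, Prod.swap_swap])]
  · simp

theorem mul_swap_apply (M : Op) (i j : Fin 2 × Fin 2) : (M * swap) i j = M i j.swap := by
  simp [swap, Matrix.mul_apply]

theorem swap_mul_self : swap * swap = 1 := by
  ext i j
  rw [swap_mul_apply]
  simp [swap, Matrix.one_apply]

theorem swap_mul_kronecker (A B : Matrix (Fin 2) (Fin 2) ℂ) :
    swap * (A ⊗ₖ B) = (B ⊗ₖ A) * swap := by
  ext i j
  rw [swap_mul_apply, mul_swap_apply]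
  simp [mul_comm]

theorem transpose_swap : swapᵀ = swap := by
  ext ⟨a, b⟩ ⟨c, d⟩
  simp [swap, Prod.ext_iff, eq_comm, and_comm]

theorem det_swap : swap.det = -1 := by
  have h : swap = Equiv.Perm.permMatrix ℂ (Equiv.prodComm (Fin 2) (Fin 2)) := by
    ext i j
    simp [swap, Equiv.Perm.permMatrix, PEquiv.toMatrix_apply, Prod.ext_iff, eq_comm, and_comm]
  rw [h, Matrix.det_permutation]
  have : Equiv.Perm.sign (Equiv.prodComm (Fin 2) (Fin 2) : Equiv.Perm (Fin 2 × Fin 2)) = -1 := by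
    decide
  simp [this]

/-- The first two columns are orthogonal product vectors, so they share a left or a right factor. If
the right one is shared, `swap * M` is a Kronecker product preserving the form, hence of determinant
1, whereas `swap` has determinant -1. -/
theorem exists_kronecker {M : Op} (hM : M * spinFlip * Mᵀ = spinFlip) (hd : M.det = 1) :
    ∃ A B : Matrix (Fin 2) (Fin 2) ℂ, A.det * B.det = 1 ∧ M = A ⊗ₖ B := by
  have hT := transpose_mul_spinFlip hM
  have hdet : ∀ {N : Op} {A B : Matrix (Fin 2) (Fin 2) ℂ}, N * spinFlip * Nᵀ = spinFlip →
      N = A ⊗ₖ B → A.det * B.det = 1 := by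
    rintro N A B hN rfl
    rw [kronecker_mul_spinFlip] at hN
    have := congrFun (congrFun hN (0, 1)) (1, 0)
    simpa [spinFlip_apply, pauli] using this
  obtain ⟨u, v, h00⟩ := exists_product_column hT (0, 0)
  obtain ⟨u', v', h01⟩ := exists_product_column hT (0, 1)
  have f1 := spinFlip_form_product hT _ _ h00 h01
  obtain ⟨p, q, h11⟩ := exists_product_column hT (1, 1)
  have f3 := spinFlip_form_product hT _ _ h00 h11
  simp [spinFlip_apply, pauli] at f1 f3
  have hu : u ≠ 0 := by rintro rfl; simp [area] at f3
  have hv : v ≠ 0 := by rintro rfl; simp [area] at f3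
  rcases f1 with f1 | f1
  · obtain ⟨k, rfl⟩ := exists_smul_of_area_eq_zero hu f1
    obtain ⟨A, B, h⟩ := exists_kronecker_of_common_factor hT (v' := k • v') h00 (fun a b => by
      rw [h01, Pi.smul_apply, Pi.smul_apply, smul_eq_mul, smul_eq_mul]; ring)
    exact ⟨A, B, hdet hM h, h⟩
  · exfalso
    obtain ⟨k, rfl⟩ := exists_smul_of_area_eq_zero hv f1
    have hs : swap * spinFlip * swap = spinFlip := by
      rw [spinFlip, swap_mul_kronecker, Matrix.mul_assoc, swap_mul_self, Matrix.mul_one]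
    have hN : (swap * M) * spinFlip * (swap * M)ᵀ = spinFlip := by
      rw [Matrix.transpose_mul, transpose_swap]
      calc swap * M * spinFlip * (Mᵀ * swap) = swap * (M * spinFlip * Mᵀ) * swap := by
            simp only [Matrix.mul_assoc]
        _ = spinFlip := by rw [hM, hs]
    obtain ⟨A, B, h⟩ := exists_kronecker_of_common_factor (transpose_mul_spinFlip hN)
      (u := v) (v := u) (v' := k • u')
      (fun a b => by rw [swap_mul_apply]; simp [h00, mul_comm])
      (fun a b => by rw [swap_mul_apply]; simp [h01]; ring)
    have h1 := hdet hN h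
    have h2 := congrArg Matrix.det h
    rw [Matrix.det_mul, det_swap, hd, Matrix.det_kronecker] at h2
    simp only [Fintype.card_fin] at h2
    rw [← mul_pow, h1] at h2
    norm_num at h2

/-- A special unitary operator preserving the spin-flip form is local. -/
theorem exists_local {M : Op} (hU : M * Mᴴ = 1) (hM : M * spinFlip * Mᵀ = spinFlip)
    (hd : M.det = 1) : ∃ A ∈ SU2, ∃ B ∈ SU2, M = A ⊗ₖ B := by
  obtain ⟨A, B, hAB, rfl⟩ := exists_kronecker hM hd
  -- Only the product of the two determinants is known to be 1; shifting a square root of `A.det`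
  -- between the factors makes each of them 1.
  obtain ⟨r, hr⟩ := IsAlgClosed.exists_pow_nat_eq A.det (n := 2) (by norm_num)
  have hA : A.det ≠ 0 := left_ne_zero_of_mul_eq_one hAB
  have hr0 : r ≠ 0 := by rintro rfl; exact hA (by rw [← hr]; norm_num)
  have hA' : (r⁻¹ • A).det = 1 := by
    rw [Matrix.det_smul, Fintype.card_fin, ← hr, inv_pow, inv_mul_cancel₀ (pow_ne_zero 2 hr0)]
  have hB' : (r • B).det = 1 := by
    rw [Matrix.det_smul, Fintype.card_fin, hr, hAB]
  have hk : (r⁻¹ • A) ⊗ₖ (r • B) = A ⊗ₖ B := by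
    rw [Matrix.smul_kronecker, Matrix.kronecker_smul, smul_smul, inv_mul_cancel₀ hr0, one_smul]
  rw [← hk] at hU ⊢
  generalize r⁻¹ • A = A' at *
  generalize r • B = B' at *
  rw [Matrix.conjTranspose_kronecker, ← Matrix.mul_kronecker_mul] at hU
  have e : ∀ i j k l, (A' * A'ᴴ) i j * (B' * B'ᴴ) k l = (1 : Op) (i, k) (j, l) :=
    fun i j k l => congrFun (congrFun hU (i, k)) (j, l)
  have hP : (A' * A'ᴴ).det = 1 := by
    rw [Matrix.det_mul, Matrix.det_conjTranspose, hA']; simp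
  -- Unitarity of the Kronecker product will make `A' * A'ᴴ` scalar. The scalar is nonnegative, and
  -- determinant 1 makes its square 1.
  have hpos : ∃ s : ℝ, 0 ≤ s ∧ (A' * A'ᴴ) 0 0 = s := by
    refine ⟨‖A' 0 0‖ ^ 2 + ‖A' 0 1‖ ^ 2, by positivity, ?_⟩
    simp [Matrix.mul_apply, Fin.sum_univ_two, Complex.mul_conj, Complex.normSq_eq_norm_sq]
  obtain ⟨s, hs0, hs⟩ := hpos
  have e00 := e 0 0 0 0
  have e10 := e 1 1 0 0
  have e01 := e 0 1 0 0
  have e11 := e 1 0 0 0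
  rw [Matrix.one_apply] at e00 e10 e01 e11
  simp at e00 e10 e01 e11
  have hQ : (B' * B'ᴴ) 0 0 ≠ 0 := right_ne_zero_of_mul_eq_one e00
  have p01 := e01.resolve_right hQ
  have p10 := e11.resolve_right hQ
  have p11 : (A' * A'ᴴ) 1 1 = (A' * A'ᴴ) 0 0 := mul_right_cancel₀ hQ (e10.trans e00.symm)
  have hs1 : s = 1 := by
    rw [Matrix.det_fin_two, p01, p10, p11, hs] at hP
    have : s * s = 1 := by
      have := hP; rw [mul_zero, sub_zero] at this; exact_mod_cast this
    nlinarith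
  have hs' : (A' * A'ᴴ) 0 0 = 1 := by rw [hs, hs1, Complex.ofReal_one]
  have hPA : A' * A'ᴴ = 1 := by
    ext i j
    fin_cases i <;> fin_cases j
    · simpa using hs'
    · simpa using p01
    · simpa using p10
    · simpa using p11.trans hs'
  have hQB : B' * B'ᴴ = 1 := by
    ext k l
    have := e 0 0 k l
    rw [hs', one_mul] at this
    rw [this]
    simp [Matrix.one_apply]
  refine ⟨A', ?_, B', ?_, rfl⟩
  · exact Matrix.mem_specialUnitaryGroup_iff.mpr ⟨Matrix.mem_unitaryGroup_iff.mpr hPA, hA'⟩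
  · exact Matrix.mem_specialUnitaryGroup_iff.mpr ⟨Matrix.mem_unitaryGroup_iff.mpr hQB, hB'⟩

/-! ### The magic basis and the canonical decomposition -/

/-- The unnormalized magic basis: the entry `i j` is the component at `i` of the vector `j`. -/
noncomputable def bell : Op := Matrix.of fun i j =>
  ![![![![1, Complex.I], ![0, 0]], ![![0, 0], ![Complex.I, 1]]],
    ![![![0, 0], ![Complex.I, -1]], ![![1, -Complex.I], ![0, 0]]]] i.1 i.2 j.1 j.2

theorem bell_mul_conjTranspose : bell * bellᴴ = (2 : ℂ) • 1 := by
  ext ⟨a, b⟩ ⟨c, d⟩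
  fin_cases a <;> fin_cases b <;> fin_cases c <;> fin_cases d <;>
    simp [bell, Matrix.mul_apply, Fintype.sum_prod_type, Fin.sum_univ_two] <;> norm_num

theorem bell_mul_transpose : bell * bellᵀ = (-2 : ℂ) • spinFlip := by
  ext ⟨a, b⟩ ⟨c, d⟩
  fin_cases a <;> fin_cases b <;> fin_cases c <;> fin_cases d <;>
    simp [bell, Matrix.mul_apply, Fintype.sum_prod_type, Fin.sum_univ_two, spinFlip, pauli] <;>
    norm_num

/-- The magic basis. -/
noncomputable def magic : Op := (((√2 : ℝ) : ℂ)⁻¹) • bell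

theorem inv_sqrt_two_mul_self : (((√2 : ℝ) : ℂ)⁻¹) * (((√2 : ℝ) : ℂ)⁻¹) = 1 / 2 := by
  rw [← mul_inv, ← Complex.ofReal_mul, Real.mul_self_sqrt (by norm_num)]
  norm_num

theorem magic_mul_conjTranspose : magic * magicᴴ = 1 := by
  have hs : star (((√2 : ℝ) : ℂ)⁻¹) = (((√2 : ℝ) : ℂ)⁻¹) := by
    rw [Complex.star_def, map_inv₀, Complex.conj_ofReal]
  rw [magic, Matrix.conjTranspose_smul, Matrix.smul_mul, Matrix.mul_smul, smul_smul,
    bell_mul_conjTranspose, smul_smul, hs, inv_sqrt_two_mul_self]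
  norm_num

theorem conjTranspose_mul_magic : magicᴴ * magic = 1 :=
  mul_eq_one_comm.mp magic_mul_conjTranspose

theorem magic_mul_transpose : magic * magicᵀ = -spinFlip := by
  rw [magic, Matrix.transpose_smul, Matrix.smul_mul, Matrix.mul_smul, smul_smul,
    bell_mul_transpose, smul_smul, inv_sqrt_two_mul_self]
  norm_num

theorem conjTranspose_transpose_mul (A : Op) (h : Aᴴ * A = 1) : Aᵀ * Aᴴᵀ = 1 := by
  rw [← Matrix.transpose_mul, h, Matrix.transpose_one]

theorem det_magic_mul : magic.det * magicᴴ.det = 1 := by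
  rw [← Matrix.det_mul, magic_mul_conjTranspose, Matrix.det_one]

/-- In the magic basis, special orthogonal matrices are local operators. -/
theorem exists_local_of_orthogonal {K : Op} (hU : K * Kᴴ = 1) (hO : K * Kᵀ = 1)
    (hd : K.det = 1) : ∃ A ∈ SU2, ∃ B ∈ SU2, magic * K * magicᴴ = A ⊗ₖ B := by
  refine exists_local ?_ ?_ ?_
  · calc magic * K * magicᴴ * (magic * K * magicᴴ)ᴴ
        = magic * (K * (magicᴴ * magic) * Kᴴ) * magicᴴ := by
          simp only [Matrix.conjTranspose_mul, Matrix.conjTranspose_conjTranspose, Matrix.mul_assoc]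
      _ = 1 := by
          rw [conjTranspose_mul_magic, Matrix.mul_one, hU, Matrix.mul_one, magic_mul_conjTranspose]
  · have hs : spinFlip = -(magic * magicᵀ) := by rw [magic_mul_transpose, neg_neg]
    calc magic * K * magicᴴ * spinFlip * (magic * K * magicᴴ)ᵀ
        = -(magic * (K * (magicᴴ * magic) * (magicᵀ * magicᴴᵀ) * Kᵀ) * magicᵀ) := by
          rw [hs]
          simp only [Matrix.transpose_mul, Matrix.mul_assoc, Matrix.mul_neg, Matrix.neg_mul]
      _ = spinFlip := by
          rw [conjTranspose_mul_magic, conjTranspose_transpose_mul _ conjTranspose_mul_magic,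
            Matrix.mul_one, Matrix.mul_one, hO, Matrix.mul_one, hs]
  · rw [Matrix.det_mul, Matrix.det_mul, hd, mul_one, det_magic_mul]

/-- A symmetric unitary matrix is diagonalized by a real special orthogonal matrix. -/
theorem exists_specialOrthogonal_diagonalization {n : Type*} [Fintype n] [DecidableEq n]
    [Nonempty n] {S : Matrix n n ℂ} (hS : Sᵀ = S) (hU : S * Sᴴ = 1) :
    ∃ (O : Matrix n n ℂ) (d : n → ℂ), Oᵀ * O = 1 ∧ Oᴴ = Oᵀ ∧ O.det = 1 ∧
      Oᵀ * S * O = Matrix.diagonal d := by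
  have hS' : ∀ i j, S j i = S i j := fun i j => congrFun (congrFun hS i) j
  -- For symmetric S = X + iY the imaginary part of S Sᴴ is YX - XY, and it vanishes because S is
  -- unitary.
  have hcomm : Commute (S.map Complex.re) (S.map Complex.im) := by
    ext i j
    have h := congrArg Complex.im (congrFun (congrFun hU i) j)
    have h1 : ((1 : Matrix n n ℂ) i j).im = 0 := by
      rw [Matrix.one_apply]; split_ifs <;> simp
    rw [h1, Matrix.mul_apply, Complex.im_sum] at h
    simp only [Matrix.mul_apply, Matrix.map_apply]
    rw [← sub_eq_zero, ← Finset.sum_sub_distrib, ← neg_eq_zero, ← h, ← Finset.sum_neg_distrib]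
    refine Finset.sum_congr rfl fun k _ => ?_
    simp [hS' k j]
    ring
  obtain ⟨O, x, y, hO, hX, hY⟩ := exists_orthogonal_diagonalization
    (by ext i j; simp [hS' i j]) (by ext i j; simp [hS' i j]) hcomm
  -- Scaling one column by `O.det`, which is ±1, makes the determinant 1 and keeps the columns
  -- eigenvectors.
  obtain ⟨P, hP, hdet, hX, hY⟩ : ∃ P : Matrix n n ℝ, Pᵀ * P = 1 ∧ P.det = 1 ∧
      S.map Complex.re * P = P * Matrix.diagonal x ∧
      S.map Complex.im * P = P * Matrix.diagonal y := by
    have hdd : O.det * O.det = 1 := by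
      simpa using congrArg Matrix.det hO
    let i₀ : n := Classical.arbitrary n
    let σ : n → ℝ := Function.update (fun _ => 1) i₀ O.det
    have hσ : Matrix.diagonal σ * Matrix.diagonal σ = 1 := by
      rw [Matrix.diagonal_mul_diagonal, ← Matrix.diagonal_one]
      congr 1
      ext i
      by_cases h : i = i₀
      · subst h; simp [σ, hdd]
      · simp [σ, h]
    have hc : ∀ z : n → ℝ, Matrix.diagonal z * Matrix.diagonal σ
        = Matrix.diagonal σ * Matrix.diagonal z := fun z => by
      simp only [Matrix.diagonal_mul_diagonal, mul_comm]
    refine ⟨O * Matrix.diagonal σ, ?_, ?_, ?_, ?_⟩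
    · rw [Matrix.transpose_mul, Matrix.diagonal_transpose, Matrix.mul_assoc, ← Matrix.mul_assoc Oᵀ,
        hO, Matrix.one_mul, hσ]
    · rw [Matrix.det_mul, Matrix.det_diagonal, Finset.prod_update_of_mem (Finset.mem_univ _)]
      simpa using hdd
    · rw [← Matrix.mul_assoc, hX, Matrix.mul_assoc, Matrix.mul_assoc, hc]
    · rw [← Matrix.mul_assoc, hY, Matrix.mul_assoc, Matrix.mul_assoc, hc]
  have hPC : (P.map Complex.ofReal)ᵀ * P.map Complex.ofReal = 1 := by
    have := congrArg (fun M : Matrix n n ℝ => M.map Complex.ofRealHom) hP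
    simpa [Matrix.map_mul, Matrix.transpose_map] using! this
  refine ⟨P.map Complex.ofReal, fun i => x i + y i * Complex.I, hPC, ?_, ?_, ?_⟩
  · ext i j; simp
  · have := Complex.ofRealHom.map_det P
    rw [hdet] at this
    simpa using! this.symm
  · have h : S * P.map Complex.ofReal =
        P.map Complex.ofReal * Matrix.diagonal (fun i => (x i + y i * Complex.I : ℂ)) := by
      ext i j
      have h1 := congrFun (congrFun hX i) j
      have h2 := congrFun (congrFun hY i) j
      rw [Matrix.mul_diagonal] at h1 h2 ⊢
      simp only [Matrix.mul_apply, Matrix.map_apply] at h1 h2 ⊢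
      apply Complex.ext
      · simpa [Complex.re_sum] using h1
      · simpa [Complex.im_sum] using h2
    rw [Matrix.mul_assoc, h, ← Matrix.mul_assoc, hPC, Matrix.one_mul]

/-- The canonical decomposition of a special unitary operator on two qubits. -/
theorem exists_canonical_decomposition {U : Op} (hU : U * Uᴴ = 1) (hd : U.det = 1) :
    ∃ A ∈ SU2, ∃ B ∈ SU2, ∃ C ∈ SU2, ∃ D ∈ SU2, ∃ e : Fin 2 × Fin 2 → ℂ, (∀ k, ‖e k‖ = 1) ∧
      U = (A ⊗ₖ B) * (magic * Matrix.diagonal e * magicᴴ) * (C ⊗ₖ D) := by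
  set V : Op := magicᴴ * U * magic with hV
  have hVU : V * Vᴴ = 1 := by
    calc V * Vᴴ = magicᴴ * (U * (magic * magicᴴ) * Uᴴ) * magic := by
          rw [hV]
          simp only [Matrix.conjTranspose_mul, Matrix.conjTranspose_conjTranspose, Matrix.mul_assoc]
      _ = 1 := by
          rw [magic_mul_conjTranspose, Matrix.mul_one, hU, Matrix.mul_one, conjTranspose_mul_magic]
  have hVd : V.det = 1 := by
    rw [hV, Matrix.det_mul, Matrix.det_mul, hd, mul_one, mul_comm, det_magic_mul]
  -- A factorization V = O e K with O and K orthogonal and e diagonal gives V Vᵀ = O e² Oᵀ. So O and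
  -- e² come from diagonalizing this symmetric unitary matrix, and K = e⁻¹ Oᵀ V is then orthogonal.
  have hSU : (V * Vᵀ) * (V * Vᵀ)ᴴ = 1 := by
    have h : Vᵀ * Vᵀᴴ = 1 := conjTranspose_transpose_mul V (mul_eq_one_comm.mp hVU)
    rw [Matrix.conjTranspose_mul, Matrix.mul_assoc, ← Matrix.mul_assoc Vᵀ, h, Matrix.one_mul, hVU]
  obtain ⟨O, d, hO, hOc, hOd, hdiag⟩ := exists_specialOrthogonal_diagonalization
    (S := V * Vᵀ) (by rw [Matrix.transpose_mul, Matrix.transpose_transpose]) hSU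
  have hO' : O * Oᵀ = 1 := mul_eq_one_comm.mp hO
  have hdn : ∀ k, ‖d k‖ = 1 := by
    have h : Matrix.diagonal d * (Matrix.diagonal d)ᴴ = 1 := by
      have hct : Oᵀᴴ = O := by rw [← hOc, Matrix.conjTranspose_conjTranspose]
      calc Matrix.diagonal d * (Matrix.diagonal d)ᴴ
          = Oᵀ * ((V * Vᵀ) * (O * Oᵀ) * (V * Vᵀ)ᴴ) * O := by
            rw [← hdiag, Matrix.conjTranspose_mul, Matrix.conjTranspose_mul Oᵀ, hct, hOc]
            simp only [Matrix.mul_assoc]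
        _ = 1 := by rw [hO', Matrix.mul_one, hSU, Matrix.mul_one, hO]
    intro k
    have := congrFun (congrFun h k) k
    rw [Matrix.diagonal_conjTranspose, Matrix.diagonal_mul_diagonal, Matrix.diagonal_apply_eq,
      Matrix.one_apply_eq, Pi.star_apply, Complex.star_def, Complex.mul_conj,
      Complex.normSq_eq_norm_sq] at this
    have h2 : ‖d k‖ ^ 2 = 1 := by exact_mod_cast this
    exact (pow_eq_one_iff_of_nonneg (norm_nonneg _) two_ne_zero).mp h2
  have hprod : ∏ k, d k = 1 := by
    rw [← Matrix.det_diagonal, ← hdiag, Matrix.det_mul, Matrix.det_mul, Matrix.det_transpose, hOd,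
      Matrix.det_mul, Matrix.det_transpose, hVd]
    norm_num
  -- Arbitrary square roots of the `d k` have product ±1; putting that sign on the root at index 0
  -- gives product 1, as needed for `K.det = 1`.
  obtain ⟨e, hen, hed, hep⟩ : ∃ e : Fin 2 × Fin 2 → ℂ, (∀ k, ‖e k‖ = 1) ∧
      (∀ k, e k * e k = d k) ∧ ∏ k, e k = 1 := by
    choose r hr using fun k => IsAlgClosed.exists_pow_nat_eq (d k) (n := 2) (by norm_num)
    have hrn : ∀ k, ‖r k‖ = 1 := fun k => by
      have h := congrArg norm (hr k)
      rw [norm_pow, hdn] at h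
      exact (pow_eq_one_iff_of_nonneg (norm_nonneg _) two_ne_zero).mp h
    have hsq : (∏ k, r k) * (∏ k, r k) = 1 := by
      rw [← Finset.prod_mul_distrib, ← hprod]
      exact Finset.prod_congr rfl fun k _ => by rw [← hr, sq]
    refine ⟨fun k => (if k = 0 then ∏ k, r k else 1) * r k, fun k => ?_, fun k => ?_, ?_⟩
    · rw [norm_mul, hrn, mul_one]
      split_ifs
      · rw [norm_prod]; simp [hrn]
      · simp
    · dsimp only
      split_ifs
      · rw [mul_mul_mul_comm, hsq, one_mul, ← hr, sq]
      · rw [one_mul, ← hr, sq]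
    · rw [Finset.prod_mul_distrib, Finset.prod_ite_eq' Finset.univ, if_pos (Finset.mem_univ _), hsq]
  have hee : ∀ k, e k * star (e k) = 1 := fun k => by
    rw [Complex.star_def, Complex.mul_conj, Complex.normSq_eq_norm_sq, hen]; simp
  have hE : Matrix.diagonal e * Matrix.diagonal (star e) = 1 := by
    rw [Matrix.diagonal_mul_diagonal, ← Matrix.diagonal_one]
    congr 1; ext k; exact hee k
  have hE' := mul_eq_one_comm.mp hE
  set K : Op := Matrix.diagonal (star e) * Oᵀ * V with hK
  obtain ⟨A, hA, B, hB, hAB⟩ := exists_local_of_orthogonal (K := O) (by rw [hOc, hO']) hO' hOd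
  obtain ⟨C, hC, D, hD, hCD⟩ := exists_local_of_orthogonal (K := K) (by
      calc K * Kᴴ = Matrix.diagonal (star e) * (Oᵀ * (V * Vᴴ) * O) * Matrix.diagonal e := by
            rw [hK, ← hOc]
            simp only [Matrix.conjTranspose_mul, Matrix.mul_assoc,
              Matrix.conjTranspose_conjTranspose, Matrix.diagonal_conjTranspose, star_star]
        _ = 1 := by rw [hVU, Matrix.mul_one, hO, Matrix.mul_one, hE']) (by
      calc K * Kᵀ = Matrix.diagonal (star e) * (Oᵀ * (V * Vᵀ) * O) * Matrix.diagonal (star e) := by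
            rw [hK]
            simp only [Matrix.transpose_mul, Matrix.mul_assoc, Matrix.transpose_transpose,
              Matrix.diagonal_transpose]
        _ = 1 := by
            rw [hdiag, Matrix.diagonal_mul_diagonal, Matrix.diagonal_mul_diagonal,
              ← Matrix.diagonal_one]
            congr 1; ext k
            rw [← hed, Pi.star_apply]
            linear_combination (e k * star (e k) + 1) * hee k) (by
      rw [hK, Matrix.det_mul, Matrix.det_mul, Matrix.det_transpose, hOd, hVd, Matrix.det_diagonal]
      simp only [Pi.star_apply, ← star_prod, hep]
      simp)
  refine ⟨A, hA, B, hB, C, hC, D, hD, e, hen, ?_⟩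
  rw [← hAB, ← hCD]
  calc U = (magic * magicᴴ) * U * (magic * magicᴴ) := by
        rw [magic_mul_conjTranspose, Matrix.one_mul, Matrix.mul_one]
    _ = magic * ((O * (Matrix.diagonal e * Matrix.diagonal (star e)) * Oᵀ) * V) * magicᴴ := by
        rw [hE, Matrix.mul_one, hO', Matrix.one_mul, hV]
        simp only [Matrix.mul_assoc]
    _ = magic * (O * (magicᴴ * magic) * Matrix.diagonal e * (magicᴴ * magic) * K) * magicᴴ := by
        rw [conjTranspose_mul_magic, Matrix.mul_one, Matrix.mul_one, hK]
        simp only [Matrix.mul_assoc]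
    _ = _ := by simp only [Matrix.mul_assoc]

/-! ### Rotations and Euler angles -/

theorem rotation_z (θ : ℝ) : rotation .z θ =
    !![Complex.exp (-(θ / 2 * Complex.I)), 0; 0, Complex.exp (θ / 2 * Complex.I)] := by
  have h1 : Complex.exp (-(θ / 2 * Complex.I)) =
      Complex.cos (θ / 2) - Complex.sin (θ / 2) * Complex.I := by
    rw [← neg_mul, Complex.exp_mul_I, Complex.cos_neg, Complex.sin_neg]; ring
  rw [h1, Complex.exp_mul_I]
  ext i j
  fin_cases i <;> fin_cases j <;> simp [rotation, pauli] <;> ring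

theorem rotation_y (θ : ℝ) : rotation .y θ =
    !![(Real.cos (θ / 2) : ℂ), -Real.sin (θ / 2); (Real.sin (θ / 2) : ℂ), Real.cos (θ / 2)] := by
  ext i j
  fin_cases i <;> fin_cases j <;> simp [rotation, pauli]
  · linear_combination Complex.sin (θ / 2) * Complex.I_sq
  · linear_combination -Complex.sin (θ / 2) * Complex.I_sq

theorem rotation_zero (n : Axis) : rotation n 0 = 1 := by
  simp [rotation]

theorem pauli_mul_self (n : Axis) : pauli n * pauli n = 1 := by
  cases n <;> (ext i j; fin_cases i <;> fin_cases j <;> simp [pauli, Matrix.mul_apply])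

theorem conjTranspose_pauli (n : Axis) : (pauli n)ᴴ = pauli n := by
  cases n <;> (ext i j; fin_cases i <;> fin_cases j <;> simp [pauli])

theorem det_rotation (n : Axis) (θ : ℝ) : (rotation n θ).det = 1 := by
  have h : ((Real.cos (θ / 2) : ℝ) : ℂ) ^ 2 + (Real.sin (θ / 2) : ℂ) ^ 2 = 1 := by
    exact_mod_cast Real.cos_sq_add_sin_sq (θ / 2)
  push_cast at h
  rw [Matrix.det_fin_two]
  cases n <;> simp [rotation, pauli]
  · linear_combination h - Complex.sin (θ / 2) ^ 2 * Complex.I_sq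
  · linear_combination h + Complex.sin (θ / 2) ^ 2 * (Complex.I ^ 2 - 1) * Complex.I_sq
  · linear_combination h - Complex.sin (θ / 2) ^ 2 * Complex.I_sq

theorem rotation_add (n : Axis) (s t : ℝ) : rotation n (s + t) = rotation n s * rotation n t := by
  have hc := Real.cos_add (s / 2) (t / 2)
  have hs := Real.sin_add (s / 2) (t / 2)
  rw [← add_div] at hc hs
  simp only [rotation, hc, hs]
  simp only [Matrix.sub_mul, Matrix.mul_sub, Matrix.smul_mul, Matrix.mul_smul, Matrix.one_mul,
    Matrix.mul_one, pauli_mul_self]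
  push_cast
  match_scalars
  · linear_combination -(Complex.sin (s / 2) * Complex.sin (t / 2)) * Complex.I_sq
  · ring

theorem rotation_mul_conjTranspose (n : Axis) (θ : ℝ) : rotation n θ * (rotation n θ)ᴴ = 1 := by
  have h : (rotation n θ)ᴴ = rotation n (-θ) := by
    simp [rotation, conjTranspose_pauli, neg_div, Matrix.conjTranspose_sub,
      Matrix.conjTranspose_smul, -Complex.ofReal_cos, -Complex.ofReal_sin]
  rw [h, ← rotation_add, add_neg_cancel, rotation_zero]

theorem rotation_mem (n : Axis) (θ : ℝ) : rotation n θ ∈ SU2 :=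
  Matrix.mem_specialUnitaryGroup_iff.mpr
    ⟨Matrix.mem_unitaryGroup_iff.mpr (rotation_mul_conjTranspose n θ), det_rotation n θ⟩

/-- Euler angles. -/
theorem exists_euler_angles {A : Matrix (Fin 2) (Fin 2) ℂ} (hA : A ∈ SU2) :
    ∃ α β γ : ℝ, A = rotation .z α * rotation .y β * rotation .z γ := by
  obtain ⟨hU, hd⟩ := Matrix.mem_specialUnitaryGroup_iff.mp hA
  have hU : A * Aᴴ = 1 := Matrix.mem_unitaryGroup_iff.mp hU
  -- Both sides are the inverse of `A`. Comparing entries shows that the first column (p, q)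
  -- determines `A`.
  have hadj : A.adjugate = Aᴴ := by
    have h : A * A.adjugate = 1 := by rw [Matrix.mul_adjugate, hd, one_smul]
    calc A.adjugate = Aᴴ * A * A.adjugate := by rw [mul_eq_one_comm.mp hU, Matrix.one_mul]
      _ = Aᴴ := by rw [Matrix.mul_assoc, h, Matrix.mul_one]
  rw [Matrix.adjugate_fin_two] at hadj
  have h11 : A 1 1 = star (A 0 0) := by simpa using congrFun (congrFun hadj 0) 0
  have h01 : A 0 1 = -star (A 1 0) := by
    have := congrFun (congrFun hadj 0) 1
    simp at this
    rw [← neg_eq_iff_eq_neg, this]; rfl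
  set p := A 0 0 with hp
  set q := A 1 0 with hq
  have hn : ‖p‖ ^ 2 + ‖q‖ ^ 2 = 1 := by
    rw [Matrix.det_fin_two, h11, h01, ← hp, ← hq] at hd
    rw [neg_mul, sub_neg_eq_add, mul_comm (star q), Complex.star_def, Complex.mul_conj,
      Complex.mul_conj, Complex.normSq_eq_norm_sq, Complex.normSq_eq_norm_sq] at hd
    exact_mod_cast hd
  have hp1 : ‖p‖ ≤ 1 := by nlinarith [norm_nonneg p, norm_nonneg q]
  have hc : Real.cos (Real.arccos ‖p‖) = ‖p‖ :=
    Real.cos_arccos (by linarith [norm_nonneg p]) hp1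
  have hs : Real.sin (Real.arccos ‖p‖) = ‖q‖ := by
    rw [Real.sin_arccos, show 1 - ‖p‖ ^ 2 = ‖q‖ ^ 2 by linarith, Real.sqrt_sq (norm_nonneg q)]
  have ep : (‖p‖ : ℂ) * Complex.exp (p.arg * Complex.I) = p := Complex.norm_mul_exp_arg_mul_I p
  have eq : (‖q‖ : ℂ) * Complex.exp (q.arg * Complex.I) = q := Complex.norm_mul_exp_arg_mul_I q
  have star_exp : ∀ (r θ : ℝ), star ((r : ℂ) * Complex.exp (θ * Complex.I)) =
      r * Complex.exp (-θ * Complex.I) := fun r θ => by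
    rw [Complex.star_def, map_mul, Complex.conj_ofReal, ← Complex.exp_conj, map_mul,
      Complex.conj_ofReal, Complex.conj_I, mul_neg, neg_mul]
  -- The y angle is fixed by the moduli of p and q; the sum and the difference of the z angles are
  -- -2 arg p and 2 arg q.
  refine ⟨q.arg - p.arg, 2 * Real.arccos ‖p‖, -p.arg - q.arg, ?_⟩
  rw [rotation_z, rotation_y, rotation_z, mul_div_cancel_left₀ _ (two_ne_zero' ℝ), hc, hs]
  ext i j
  fin_cases i <;> fin_cases j <;> simp [Matrix.mul_apply, Fin.sum_univ_two]
  · rw [← hp, mul_right_comm, ← Complex.exp_add, mul_comm]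
    refine ep.symm.trans ?_; congr 2; ring
  · rw [h01, mul_right_comm, ← Complex.exp_add, mul_comm]
    rw [← eq, star_exp]; simp; left; congr 1; ring
  · rw [← hq, mul_right_comm, ← Complex.exp_add, mul_comm]
    refine eq.symm.trans ?_; congr 2; ring
  · rw [h11, mul_right_comm, ← Complex.exp_add, mul_comm]
    rw [← ep, star_exp]; simp; left; congr 1; ring

/-! ### CNOT gates and the interaction operator -/

theorem cnot_zero_mul_apply (M : Op) (a b : Fin 2) (j : Fin 2 × Fin 2) :
    (cnot 0 * M) (a, b) j = M (a, a + b) j := by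
  obtain ⟨c, d⟩ := j
  fin_cases a <;> fin_cases b <;>
    simp [cnot, Matrix.mul_apply, Fintype.sum_prod_type, Fin.sum_univ_two]

theorem cnot_one_mul_apply (M : Op) (a b : Fin 2) (j : Fin 2 × Fin 2) :
    (cnot 1 * M) (a, b) j = M (a + b, b) j := by
  obtain ⟨c, d⟩ := j
  fin_cases a <;> fin_cases b <;>
    simp [cnot, Matrix.mul_apply, Fintype.sum_prod_type, Fin.sum_univ_two]

theorem fin_two_add_add (a b : Fin 2) : a + (a + b) = b := by
  revert a b; decide

theorem cnot_mul_self (c : Fin 2) : cnot c * cnot c = 1 := by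
  rw [← Matrix.mul_one (cnot c * cnot c), Matrix.mul_assoc]
  revert c
  refine Fin.forall_fin_two.mpr ⟨?_, ?_⟩
  · ext ⟨a, b⟩ j
    rw [cnot_zero_mul_apply, cnot_zero_mul_apply, fin_two_add_add]
  · ext ⟨a, b⟩ j
    rw [cnot_one_mul_apply, cnot_one_mul_apply, add_comm (a + b), add_comm a, fin_two_add_add]

theorem transpose_cnot (c : Fin 2) : (cnot c)ᵀ = cnot c := by
  ext ⟨a, b⟩ ⟨d, e⟩
  fin_cases c <;> fin_cases a <;> fin_cases b <;> fin_cases d <;> fin_cases e <;> simp [cnot]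

/-- Three CNOTs with three rotations in between, up to an exchange of the qubits. -/
noncomputable def interaction (a b c : ℝ) : Op :=
  cnot 1 * ((rotation .z a ⊗ₖ rotation .y b) * (cnot 0 * ((1 ⊗ₖ rotation .y c) * (cnot 1 * swap))))

/-- The phase gate on the second qubit. -/
noncomputable def phaseGate : Op := (1 : Matrix (Fin 2) (Fin 2) ℂ) ⊗ₖ !![1, 0; 0, Complex.I]

/-- Since `cnot 1 * swap = cnot 0 * cnot 1`, the CNOTs conjugate the three rotations into rotations
generated by the commuting strings σ_z⊗σ_z, σ_x⊗σ_y and σ_y⊗σ_x. Conjugation by the phase gate turns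
these, up to sign, into σ_z⊗σ_z, σ_x⊗σ_x and σ_y⊗σ_y, for which the magic basis is a common
eigenbasis. -/
theorem interaction_mul_bell (a b c : ℝ) :
    interaction a b c * (phaseGate * bell) = phaseGate * bell * Matrix.diagonal fun k =>
      ![![Complex.exp (-(a / 2 * Complex.I)) * Complex.exp (-(b / 2 * Complex.I)) *
            Complex.exp (-(c / 2 * Complex.I)),
          Complex.exp (-(a / 2 * Complex.I)) * Complex.exp (b / 2 * Complex.I) *
            Complex.exp (c / 2 * Complex.I)],
        ![Complex.exp (a / 2 * Complex.I) * Complex.exp (-(b / 2 * Complex.I)) *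
            Complex.exp (c / 2 * Complex.I),
          Complex.exp (a / 2 * Complex.I) * Complex.exp (b / 2 * Complex.I) *
            Complex.exp (-(c / 2 * Complex.I))]]
        k.1 k.2 := by
  have h1 : ∀ t : ℝ, Complex.exp (-(t / 2 * Complex.I)) =
      Complex.cos (t / 2) - Complex.sin (t / 2) * Complex.I := by
    intro t
    rw [← neg_mul, Complex.exp_mul_I, Complex.cos_neg, Complex.sin_neg]; ring
  have hP : ∀ i j, (phaseGate * bell) i j =
    ![![![![1, Complex.I], ![0, 0]], ![![0, 0], ![-1, Complex.I]]],
    ![![![0, 0], ![Complex.I, -1]], ![![Complex.I, 1], ![0, 0]]]] i.1 i.2 j.1 j.2 := by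
    rintro ⟨i, i'⟩ ⟨j, j'⟩
    fin_cases i <;> fin_cases i' <;> fin_cases j <;> fin_cases j' <;>
    simp [phaseGate, bell, Matrix.mul_apply, Fintype.sum_prod_type, Fin.sum_univ_two,
        Matrix.one_apply]
  ext ⟨i, i'⟩ ⟨j, j'⟩
  rw [Matrix.mul_diagonal, hP]
  simp only [interaction, Matrix.mul_assoc, rotation_y, rotation_z]
  rw [cnot_one_mul_apply]
  simp only [Matrix.mul_apply (M := (_ ⊗ₖ _)), Fintype.sum_prod_type, Fin.sum_univ_two,
    cnot_zero_mul_apply, cnot_one_mul_apply, swap_mul_apply, hP]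
  fin_cases i <;> fin_cases i' <;> fin_cases j <;> fin_cases j' <;>
    simp [h1, Complex.exp_mul_I] <;> grind [Complex.I_sq]

/-- Four phases are a global phase, their mean `g`, plus three parameters: `a`, `b`, `c` solve the
linear system that equates the eigenvalue phases of `interaction a b c` with the centred phases. -/
theorem magic_diagonal_eq (e : Fin 2 × Fin 2 → ℂ) (he : ∀ k, ‖e k‖ = 1) :
    ∃ ζ : ℂ, ‖ζ‖ = 1 ∧ ∃ a b c : ℝ, magic * Matrix.diagonal e * magicᴴ =
      ζ • ((1 ⊗ₖ rotation .z (-(Real.pi / 2))) * interaction a b c *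
        (1 ⊗ₖ rotation .z (Real.pi / 2))) := by
  have harg : ∀ k, e k = Complex.exp ((e k).arg * Complex.I) := fun k => by
    conv_lhs => rw [← Complex.norm_mul_exp_arg_mul_I (e k), he]
    simp
  set g : ℝ := ((e (0, 0)).arg + (e (0, 1)).arg + (e (1, 0)).arg + (e (1, 1)).arg) / 4 with hg
  let a : ℝ := (e (1, 0)).arg + (e (1, 1)).arg - 2 * g
  let b : ℝ := (e (0, 1)).arg + (e (1, 1)).arg - 2 * g
  let c : ℝ := (e (0, 1)).arg + (e (1, 0)).arg - 2 * g
  have hS : (1 ⊗ₖ rotation .z (Real.pi / 2) : Op) =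
      Complex.exp (-(((Real.pi / 2 : ℝ) : ℂ) / 2 * Complex.I)) • phaseGate := by
    rw [phaseGate, ← Matrix.kronecker_smul]
    congr 1
    rw [rotation_z]
    ext i j
    fin_cases i <;> fin_cases j <;> simp
    refine Eq.trans ?_ (congrArg _ Complex.exp_pi_div_two_mul_I)
    rw [← Complex.exp_add]
    congr 1; ring
  have hS' : (1 ⊗ₖ rotation .z (-(Real.pi / 2)) : Op) * (1 ⊗ₖ rotation .z (Real.pi / 2)) = 1 := by
    rw [← Matrix.mul_kronecker_mul, ← rotation_add, neg_add_cancel, rotation_zero, Matrix.one_mul,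
      Matrix.one_kronecker_one]
  have hN : interaction a b c * ((1 ⊗ₖ rotation .z (Real.pi / 2)) * magic) =
      (1 ⊗ₖ rotation .z (Real.pi / 2)) * magic *
        Matrix.diagonal fun k => Complex.exp (-(g * Complex.I)) * e k := by
    rw [hS, magic]
    simp only [Matrix.smul_mul, Matrix.mul_smul]
    rw [interaction_mul_bell]
    congr 5
    ext ⟨i, j⟩
    rw [harg]
    fin_cases i <;> fin_cases j <;> simp only [← Complex.exp_add] <;> simp
    all_goals
      congr 1
      simp only [a, b, c, hg]
      push_cast
      ring
  refine ⟨Complex.exp (g * Complex.I), Complex.norm_exp_ofReal_mul_I g, a, b, c, ?_⟩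
  have hD : Matrix.diagonal e = Complex.exp (g * Complex.I) •
      Matrix.diagonal fun k => Complex.exp (-(g * Complex.I)) * e k := by
    rw [← Matrix.diagonal_smul]
    congr 1
    ext k
    rw [Pi.smul_apply, smul_eq_mul, ← mul_assoc, ← Complex.exp_add, add_neg_cancel,
      Complex.exp_zero, one_mul]
  rw [hD, Matrix.mul_smul, Matrix.smul_mul]
  congr 1
  calc magic * (Matrix.diagonal fun k => Complex.exp (-(g * Complex.I)) * e k) * magicᴴ
      = ((1 ⊗ₖ rotation .z (-(Real.pi / 2)) : Op) * (1 ⊗ₖ rotation .z (Real.pi / 2))) * magic *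
        (Matrix.diagonal fun k => Complex.exp (-(g * Complex.I)) * e k) * magicᴴ := by
        rw [hS', Matrix.one_mul]
    _ = (1 ⊗ₖ rotation .z (-(Real.pi / 2)) : Op) * ((1 ⊗ₖ rotation .z (Real.pi / 2)) * magic *
        (Matrix.diagonal fun k => Complex.exp (-(g * Complex.I)) * e k)) * magicᴴ := by
        simp only [Matrix.mul_assoc]
    _ = (1 ⊗ₖ rotation .z (-(Real.pi / 2)) : Op) * interaction a b c *
        (1 ⊗ₖ rotation .z (Real.pi / 2)) * (magic * magicᴴ) := by
        rw [← hN]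
        simp only [Matrix.mul_assoc]
    _ = _ := by rw [magic_mul_conjTranspose, Matrix.mul_one]

/-- Every special unitary operator is, up to phase and local operators, an interaction. -/
theorem exists_interaction {U : Op} (hU : U * Uᴴ = 1) (hd : U.det = 1) :
    ∃ ζ : ℂ, ‖ζ‖ = 1 ∧ ∃ A ∈ SU2, ∃ B ∈ SU2, ∃ C ∈ SU2, ∃ D ∈ SU2, ∃ a b c : ℝ,
      U = ζ • ((A ⊗ₖ B) * interaction a b c * (C ⊗ₖ D)) := by
  obtain ⟨A, hA, B, hB, C, hC, D, hD, e, he, rfl⟩ := exists_canonical_decomposition hU hd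
  obtain ⟨ζ, hζ, a, b, c, h⟩ := magic_diagonal_eq e he
  refine ⟨ζ, hζ, A, hA, B * rotation .z (-(Real.pi / 2)), mul_mem hB (rotation_mem _ _), C, hC,
    rotation .z (Real.pi / 2) * D, mul_mem (rotation_mem _ _) hD, a, b, c, ?_⟩
  have h1 : A ⊗ₖ (B * rotation .z (-(Real.pi / 2))) =
      (A ⊗ₖ B) * (1 ⊗ₖ rotation .z (-(Real.pi / 2))) := by
    rw [← Matrix.mul_kronecker_mul, Matrix.mul_one]
  have h2 : C ⊗ₖ (rotation .z (Real.pi / 2) * D) =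
      (1 ⊗ₖ rotation .z (Real.pi / 2)) * (C ⊗ₖ D) := by
    rw [← Matrix.mul_kronecker_mul, Matrix.one_mul]
  rw [h, h1, h2, Matrix.mul_smul, Matrix.smul_mul]
  simp only [Matrix.mul_assoc]

/-! ### Circuits and the universal CYZ topology -/

theorem onWire_zero (A : Matrix (Fin 2) (Fin 2) ℂ) : onWire 0 A = A ⊗ₖ 1 := if_pos rfl

theorem onWire_one (A : Matrix (Fin 2) (Fin 2) ℂ) : onWire 1 A = 1 ⊗ₖ A := if_neg one_ne_zero

theorem onWire_zero_mul_one (A B : Matrix (Fin 2) (Fin 2) ℂ) :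
    onWire 0 A * onWire 1 B = A ⊗ₖ B := by
  rw [onWire_zero, onWire_one, ← Matrix.mul_kronecker_mul, Matrix.one_mul, Matrix.mul_one]

theorem onWire_mul (w : Fin 2) (A B : Matrix (Fin 2) (Fin 2) ℂ) :
    onWire w (A * B) = onWire w A * onWire w B := by
  unfold onWire
  split_ifs
  · rw [← Matrix.mul_kronecker_mul, Matrix.one_mul]
  · rw [← Matrix.mul_kronecker_mul, Matrix.one_mul]

theorem Circuit.op_append (C D : Circuit) : Circuit.op (C ++ D) = Circuit.op D * Circuit.op C := by
  induction C with
  | nil => simp [Circuit.op]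
  | cons g C ih => rw [List.cons_append, Circuit.op, Circuit.op, ih, Matrix.mul_assoc]

/-- The topology of an arbitrary local operator. -/
def localTopology : Topology :=
  [.rot .z 1, .rot .y 1, .rot .z 1, .rot .z 0, .rot .y 0, .rot .z 0]

theorem exists_local_circuit {A B : Matrix (Fin 2) (Fin 2) ℂ} (hA : A ∈ SU2) (hB : B ∈ SU2) :
    ∃ C : Circuit, C.topology = localTopology ∧ Circuit.op C = A ⊗ₖ B := by
  obtain ⟨α, β, γ, rfl⟩ := exists_euler_angles hA
  obtain ⟨α', β', γ', rfl⟩ := exists_euler_angles hB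
  refine ⟨[.rot .z 1 γ', .rot .y 1 β', .rot .z 1 α', .rot .z 0 γ, .rot .y 0 β, .rot .z 0 α],
    rfl, ?_⟩
  rw [← onWire_zero_mul_one]
  simp only [onWire_mul, Circuit.op, Gate.op, Matrix.one_mul, Matrix.mul_assoc]

/-- The topology of a general operator over CNOT, `R_y` and `R_z`. -/
def universalTopology : Topology :=
  localTopology ++ [.cnot 1, .rot .y 1, .cnot 0, .rot .y 1, .rot .z 0, .cnot 1] ++ localTopology

theorem exists_interaction_circuit (a b c : ℝ) : ∃ C : Circuit,
    C.topology = [.cnot 1, .rot .y 1, .cnot 0, .rot .y 1, .rot .z 0, .cnot 1] ∧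
      Circuit.op C * swap = interaction a b c := by
  refine ⟨[.cnot 1, .rot .y 1 c, .cnot 0, .rot .y 1 b, .rot .z 0 a, .cnot 1], rfl, ?_⟩
  rw [interaction, ← onWire_zero_mul_one, ← onWire_one]
  simp only [Circuit.op, Gate.op, Matrix.one_mul, Matrix.mul_assoc]

theorem SU4_mul_conjTranspose (U : SU4) : (U : Op) * (U : Op)ᴴ = 1 :=
  Matrix.mem_unitaryGroup_iff.mp (Matrix.mem_specialUnitaryGroup_iff.mp U.2).1

theorem SU4_det (U : SU4) : (U : Op).det = 1 := (Matrix.mem_specialUnitaryGroup_iff.mp U.2).2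

theorem swap_mul_conjTranspose : swap * swapᴴ = 1 := by
  have h : swapᴴ = swap := by
    rw [Matrix.conjTranspose, transpose_swap]
    ext i j
    simp only [swap, Matrix.map_apply, Matrix.of_apply]
    split_ifs <;> simp
  rw [h, swap_mul_self]

theorem exists_pow_four_eq_neg_one : ∃ ω : ℂ, ‖ω‖ = 1 ∧ ω ^ 4 = -1 := by
  refine ⟨Complex.exp ((Real.pi / 4 : ℝ) * Complex.I), Complex.norm_exp_ofReal_mul_I _, ?_⟩
  rw [← Complex.exp_nat_mul, ← Complex.exp_pi_mul_I]
  congr 1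
  push_cast
  ring

theorem mul_star_eq_one {ω : ℂ} (h : ‖ω‖ = 1) : ω * star ω = 1 := by
  rw [Complex.star_def, Complex.mul_conj, Complex.normSq_eq_norm_sq, h]; simp

theorem universalTopology_isUniversal : universalTopology.IsUniversal := by
  refine Set.eq_univ_of_forall fun U => ?_
  obtain ⟨ω, hω, hω4⟩ := exists_pow_four_eq_neg_one
  have hω0 : ω ≠ 0 := by rintro rfl; simp at hω
  obtain ⟨ζ, hζ, A, hA, B, hB, C, hC, D, hD, a, b, c, h⟩ :=
    -- An interaction is a circuit followed on the right by `swap`, so U · swap is decomposed; the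
    -- factor ω with ω⁴ = -1 compensates the determinant -1 of `swap`.
    exists_interaction (U := ω • ((U : Op) * swap)) (by
      rw [Matrix.conjTranspose_smul, Matrix.smul_mul, Matrix.mul_smul, smul_smul,
        mul_star_eq_one hω, one_smul, Matrix.conjTranspose_mul, Matrix.mul_assoc,
        ← Matrix.mul_assoc swap, swap_mul_conjTranspose, Matrix.one_mul, SU4_mul_conjTranspose]) (by
      rw [Matrix.det_smul, Matrix.det_mul, SU4_det, det_swap]
      simp [hω4])
  obtain ⟨C₁, hT₁, h₁⟩ := exists_local_circuit hA hB
  obtain ⟨C₂, hT₂, h₂⟩ := exists_interaction_circuit a b c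
  -- The factors are exchanged because the remaining `swap` is moved past C ⊗ D.
  obtain ⟨C₃, hT₃, h₃⟩ := exists_local_circuit hD hC
  refine ⟨C₃ ++ C₂ ++ C₁, ?_, ω⁻¹ * ζ, ?_, ?_⟩
  · simp only [Circuit.topology, List.map_append] at *
    rw [hT₁, hT₂, hT₃, universalTopology]
  · rw [norm_mul, norm_inv, hω, hζ]; norm_num
  · have hU : (U : Op) = ω⁻¹ • ((ω • ((U : Op) * swap)) * swap) := by
      rw [Matrix.smul_mul, smul_smul, inv_mul_cancel₀ hω0, one_smul, Matrix.mul_assoc,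
        swap_mul_self, Matrix.mul_one]
    rw [hU, h, Matrix.smul_mul, smul_smul]
    congr 1
    rw [Circuit.op_append, Circuit.op_append, h₁, h₃, ← h₂]
    simp only [Matrix.mul_assoc]
    rw [← swap_mul_kronecker, ← Matrix.mul_assoc swap, swap_mul_self, Matrix.one_mul]

/-! ### Hadamard conjugation: from CYZ to CXY -/

/-- The exchange of the `x` and `z` axes. -/
def Axis.exchange : Axis → Axis
  | .x => .z
  | .y => .y
  | .z => .x

/-- Conjugation of a gate by Hadamard gates on both wires. -/
def Gate.hadamard : Gate → Gate
  | .cnot c => .cnot (1 - c)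
  | .rot .y w θ => .rot .y w (-θ)
  | .rot n w θ => .rot n.exchange w θ

/-- The effect on placeholders of a conjugation by Hadamard gates on both wires. -/
def Placeholder.hadamard : Placeholder → Placeholder
  | .cnot c => .cnot (1 - c)
  | .rot n w => .rot n.exchange w

theorem Gate.placeholder_hadamard (g : Gate) : g.hadamard.placeholder = g.placeholder.hadamard := by
  rcases g with c | ⟨_ | _ | _, w, θ⟩ <;> rfl

/-- The unnormalized Hadamard gate. -/
def hadamardMatrix : Matrix (Fin 2) (Fin 2) ℂ := !![1, 1; 1, -1]

/-- Hadamard gates on both wires. -/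
noncomputable def hadamardOp : Op := (1 / 2 : ℂ) • (hadamardMatrix ⊗ₖ hadamardMatrix)

theorem hadamardMatrix_mul_self : hadamardMatrix * hadamardMatrix = (2 : ℂ) • 1 := by
  ext i j
  fin_cases i <;> fin_cases j <;>
    simp [hadamardMatrix, Matrix.mul_apply, Fin.sum_univ_two] <;> norm_num

theorem hadamardOp_mul_self : hadamardOp * hadamardOp = 1 := by
  rw [hadamardOp, Matrix.smul_mul, Matrix.mul_smul, ← Matrix.mul_kronecker_mul,
    hadamardMatrix_mul_self, Matrix.smul_kronecker, Matrix.kronecker_smul,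
    Matrix.one_kronecker_one, smul_smul, smul_smul, smul_smul]
  norm_num

theorem conjTranspose_hadamardOp : hadamardOpᴴ = hadamardOp := by
  have h : hadamardMatrixᴴ = hadamardMatrix := by
    ext i j
    fin_cases i <;> fin_cases j <;> simp [hadamardMatrix]
  rw [hadamardOp, Matrix.conjTranspose_smul, Matrix.conjTranspose_kronecker, h]
  simp

theorem det_hadamardOp : hadamardOp.det = 1 := by
  rw [hadamardOp, Matrix.det_smul, Matrix.det_kronecker, hadamardMatrix, Matrix.det_fin_two_of]
  norm_num

theorem hadamardMatrix_mul_rotation (n : Axis) (θ : ℝ) (h : n ≠ .y) :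
    hadamardMatrix * rotation n θ = rotation n.exchange θ * hadamardMatrix := by
  cases n
  · ext i j
    fin_cases i <;> fin_cases j <;>
      simp [hadamardMatrix, rotation, pauli, Axis.exchange, Matrix.mul_apply,
        Fin.sum_univ_two] <;> ring
  · exact absurd rfl h
  · ext i j
    fin_cases i <;> fin_cases j <;>
      simp [hadamardMatrix, rotation, pauli, Axis.exchange, Matrix.mul_apply,
        Fin.sum_univ_two] <;> ring

theorem hadamardMatrix_mul_rotation_y (θ : ℝ) :
    hadamardMatrix * rotation .y θ = rotation .y (-θ) * hadamardMatrix := by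
  ext i j
  fin_cases i <;> fin_cases j <;>
    simp [hadamardMatrix, rotation, pauli, neg_div, Matrix.mul_apply, Fin.sum_univ_two] <;> ring

theorem hadamardOp_mul_onWire (w : Fin 2) {A B : Matrix (Fin 2) (Fin 2) ℂ}
    (h : hadamardMatrix * A = B * hadamardMatrix) :
    hadamardOp * onWire w A = onWire w B * hadamardOp := by
  rw [hadamardOp, Matrix.smul_mul, Matrix.mul_smul]
  congr 1
  unfold onWire
  split_ifs <;> simp only [← Matrix.mul_kronecker_mul, h, Matrix.one_mul, Matrix.mul_one]

theorem hadamardOp_mul_cnot (c : Fin 2) : hadamardOp * cnot c = cnot (1 - c) * hadamardOp := by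
  rw [hadamardOp, Matrix.smul_mul, Matrix.mul_smul]
  congr 1
  ext ⟨a, b⟩ ⟨d, e⟩
  fin_cases c <;> fin_cases a <;> fin_cases b <;> fin_cases d <;> fin_cases e <;>
    simp [cnot, hadamardMatrix, Matrix.mul_apply, Fintype.sum_prod_type, Fin.sum_univ_two]

theorem hadamardOp_mul_gate (g : Gate) : hadamardOp * g.op = g.hadamard.op * hadamardOp := by
  rcases g with c | ⟨_ | _ | _, w, θ⟩
  · exact hadamardOp_mul_cnot c
  · exact hadamardOp_mul_onWire w (hadamardMatrix_mul_rotation _ θ (by simp))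
  · exact hadamardOp_mul_onWire w (hadamardMatrix_mul_rotation_y θ)
  · exact hadamardOp_mul_onWire w (hadamardMatrix_mul_rotation _ θ (by simp))

theorem hadamardOp_mul_circuit (C : Circuit) :
    hadamardOp * Circuit.op C = Circuit.op (C.map Gate.hadamard) * hadamardOp := by
  induction C with
  | nil => simp [Circuit.op]
  | cons g C ih =>
    rw [List.map_cons, Circuit.op, Circuit.op, ← Matrix.mul_assoc, ih, Matrix.mul_assoc,
      hadamardOp_mul_gate, Matrix.mul_assoc]

/-- Conjugation by the Hadamard operator is an involution of SU(4) that acts gate by gate, so a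
circuit for HUH becomes one for U. The angles being free, the sign change in y rotations is
harmless. -/
theorem Topology.IsUniversal.hadamard {T : Topology} (hT : T.IsUniversal) :
    Topology.IsUniversal (T.map Placeholder.hadamard) := by
  refine Set.eq_univ_of_forall fun U => ?_
  have hmem : hadamardOp ∈ Matrix.specialUnitaryGroup (Fin 2 × Fin 2) ℂ :=
    Matrix.mem_specialUnitaryGroup_iff.mpr ⟨Matrix.mem_unitaryGroup_iff.mpr (by
      rw [Matrix.star_eq_conjTranspose, conjTranspose_hadamardOp, hadamardOp_mul_self]),
      det_hadamardOp⟩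
  let H : SU4 := ⟨hadamardOp, hmem⟩
  have hV : H * U * H ∈ T.Q := by rw [hT]; trivial
  obtain ⟨C, hC, ζ, hζ, h⟩ := hV
  refine ⟨C.map Gate.hadamard, ?_, ζ, hζ, ?_⟩
  · rw [← hC]
    simp only [Circuit.topology, List.map_map]
    exact List.map_congr_left fun g _ => g.placeholder_hadamard
  · have h' : hadamardOp * (U : Op) * hadamardOp = ζ • Circuit.op C := h
    calc (U : Op) = hadamardOp * (hadamardOp * (U : Op) * hadamardOp) * hadamardOp := by
          simp only [Matrix.mul_assoc, hadamardOp_mul_self, Matrix.mul_one]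
          rw [← Matrix.mul_assoc, hadamardOp_mul_self, Matrix.one_mul]
      _ = ζ • Circuit.op (C.map Gate.hadamard) := by
          rw [h', Matrix.mul_smul, Matrix.smul_mul, hadamardOp_mul_circuit, Matrix.mul_assoc,
            hadamardOp_mul_self, Matrix.mul_one]

theorem exists_universal_yz : ∃ T : Topology, T.InLibrary {.y, .z} ∧ T.AllButOutside 3 ∧
    T.IsUniversal := by
  refine ⟨universalTopology, fun n w h => ?_, ⟨localTopology, _, localTopology, rfl, ?_, ?_, ?_⟩,
    universalTopology_isUniversal⟩
  · simp [universalTopology, localTopology] at h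
    aesop
  · simp [localTopology, Placeholder.isRot]
  · simp [localTopology, Placeholder.isRot]
  · simp [List.countP_cons, Placeholder.isRot]

theorem exists_universal_xy : ∃ T : Topology, T.InLibrary {.x, .y} ∧ T.AllButOutside 3 ∧
    T.IsUniversal := by
  refine ⟨universalTopology.map Placeholder.hadamard, fun n w h => ?_,
    ⟨localTopology.map Placeholder.hadamard, _, localTopology.map Placeholder.hadamard,
      by rw [universalTopology, List.map_append, List.map_append], ?_, ?_, ?_⟩,
    universalTopology_isUniversal.hadamard⟩
  · simp [universalTopology, localTopology, Placeholder.hadamard, Axis.exchange] at h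
    aesop
  · simp [localTopology, Placeholder.isRot, Placeholder.hadamard]
  · simp [localTopology, Placeholder.isRot, Placeholder.hadamard]
  · simp [List.countP_cons, Placeholder.isRot, Placeholder.hadamard]

/-! ### Pauli strings as bit vectors -/

/-- The sign `(-1) ^ s`. -/
def bitSign (s : Fin 2) : ℂ := ![1, -1] s

theorem bitSign_add (s t : Fin 2) : bitSign (s + t) = bitSign s * bitSign t := by
  fin_cases s <;> fin_cases t <;> simp [bitSign]

theorem bitSign_mul_self (s : Fin 2) : bitSign s * bitSign s = 1 := by
  fin_cases s <;> simp [bitSign]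

/-- The inner product of two bit strings. -/
def dotBits (a b : Fin 2 × Fin 2) : Fin 2 := a.1 * b.1 + a.2 * b.2

theorem dotBits_add (a b c : Fin 2 × Fin 2) : dotBits a (b + c) = dotBits a b + dotBits a c := by
  revert a b c; decide

/-- The Pauli string with factors `σ_x` at the positions given by `a`. -/
noncomputable def xString (a : Fin 2 × Fin 2) : Op :=
  Matrix.of fun i j => if i = j + a then 1 else 0

/-- The Pauli string with factors `σ_z` at the positions given by `b`. -/
noncomputable def zString (b : Fin 2 × Fin 2) : Op := Matrix.diagonal fun i => bitSign (dotBits b i)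

theorem bits_eq_add_iff (i j a : Fin 2 × Fin 2) : i = j + a ↔ j = i + a := by
  revert i j a; decide

theorem xString_mul_apply (a : Fin 2 × Fin 2) (M : Op) (i j : Fin 2 × Fin 2) :
    (xString a * M) i j = M (i + a) j := by
  simp only [xString, Matrix.mul_apply, Matrix.of_apply, bits_eq_add_iff i, ite_mul, one_mul,
    zero_mul, Finset.sum_ite_eq', Finset.mem_univ, if_true]

theorem xString_mul_xString (a b : Fin 2 × Fin 2) : xString a * xString b = xString (a + b) := by
  ext i j
  rw [xString_mul_apply]
  simp only [xString, Matrix.of_apply]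
  congr 1
  rw [eq_iff_iff]
  revert i j a b; decide

theorem xString_zero : xString 0 = 1 := by
  ext i j
  simp [xString, Matrix.one_apply]

theorem zString_mul_zString (a b : Fin 2 × Fin 2) : zString a * zString b = zString (a + b) := by
  rw [zString, zString, zString, Matrix.diagonal_mul_diagonal]
  congr 1
  ext i
  rw [← bitSign_add]
  congr 1
  revert i a b; decide

theorem zString_zero : zString 0 = 1 := by
  rw [zString, ← Matrix.diagonal_one]
  congr 1
  ext i
  rw [show dotBits 0 i = 0 by revert i; decide]
  rfl

theorem bits_add_self (a : Fin 2 × Fin 2) : a + a = 0 := by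
  revert a; decide

theorem zString_mul_xString (b a : Fin 2 × Fin 2) :
    zString b * xString a = bitSign (dotBits b a) • (xString a * zString b) := by
  ext i j
  rw [zString, Matrix.diagonal_mul, Matrix.smul_apply, Matrix.mul_diagonal]
  simp only [xString, Matrix.of_apply]
  split_ifs with h
  · rw [h, dotBits_add, bitSign_add, smul_eq_mul]; ring
  · simp

/-- The Pauli strings consisting of factors `σ_x` only or of factors `σ_z` only. -/
noncomputable def pauliString (p : Bool × (Fin 2 × Fin 2)) : Op :=
  if p.1 then zString p.2 else xString p.2

theorem pauliString_mul_self (p : Bool × (Fin 2 × Fin 2)) : pauliString p * pauliString p = 1 := by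
  unfold pauliString
  split_ifs
  · rw [zString_mul_zString, bits_add_self, zString_zero]
  · rw [xString_mul_xString, bits_add_self, xString_zero]

theorem pauliString_comm {p q : Bool × (Fin 2 × Fin 2)} (h : p.1 = q.1) :
    pauliString p * pauliString q = pauliString q * pauliString p := by
  unfold pauliString
  rw [h]
  split_ifs
  · rw [zString_mul_zString, zString_mul_zString, add_comm]
  · rw [xString_mul_xString, xString_mul_xString, add_comm]

theorem transpose_pauliString (p : Bool × (Fin 2 × Fin 2)) : (pauliString p)ᵀ = pauliString p := by
  unfold pauliString
  split_ifs
  · exact Matrix.diagonal_transpose _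
  · ext i j
    simp only [xString, Matrix.transpose_apply, Matrix.of_apply, bits_eq_add_iff j]

theorem star_bitSign (s : Fin 2) : star (bitSign s) = bitSign s := by
  fin_cases s <;> simp [bitSign]

theorem map_star_pauliString (p : Bool × (Fin 2 × Fin 2)) :
    (pauliString p).map star = pauliString p := by
  unfold pauliString
  split_ifs
  · rw [zString, Matrix.diagonal_map (star_zero ℂ)]
    congr 1
    ext i
    exact star_bitSign _
  · ext i j
    simp only [xString, Matrix.map_apply, Matrix.of_apply]
    split_ifs <;> simp

/-- A general Pauli string up to phase. -/
noncomputable def mixedString (c d : Fin 2 × Fin 2) : Op := xString c * zString d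

/-- Whether a Pauli string anticommutes with `mixedString c d`. -/
def pairing (c d : Fin 2 × Fin 2) (p : Bool × (Fin 2 × Fin 2)) : Fin 2 :=
  if p.1 then dotBits p.2 c else dotBits d p.2

theorem mixedString_mul_pauliString (c d : Fin 2 × Fin 2) (p : Bool × (Fin 2 × Fin 2)) :
    mixedString c d * pauliString p =
      bitSign (pairing c d p) • (pauliString p * mixedString c d) := by
  unfold pauliString pairing mixedString
  split_ifs
  · rw [← Matrix.mul_assoc (zString p.2), zString_mul_xString, Matrix.smul_mul, smul_smul,
      bitSign_mul_self, one_smul, Matrix.mul_assoc, Matrix.mul_assoc, zString_mul_zString,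
      zString_mul_zString, add_comm]
  · rw [Matrix.mul_assoc, zString_mul_xString, Matrix.mul_smul, ← Matrix.mul_assoc,
      ← Matrix.mul_assoc, xString_mul_xString, xString_mul_xString, add_comm]

theorem mixedString_mul_mixedString (c d a b : Fin 2 × Fin 2) :
    ∃ s : Fin 2, mixedString c d * mixedString a b =
      bitSign s • (mixedString a b * mixedString c d) := by
  refine ⟨pairing c d (false, a) + pairing c d (true, b), ?_⟩
  have hx := mixedString_mul_pauliString c d (false, a)
  have hz := mixedString_mul_pauliString c d (true, b)
  simp only [pauliString, if_true, Bool.false_eq_true, if_false] at hx hz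
  rw [mixedString.eq_def a b, ← Matrix.mul_assoc, hx, Matrix.smul_mul, Matrix.mul_assoc, hz,
    Matrix.mul_smul, smul_smul, bitSign_add, Matrix.mul_assoc]

theorem exists_mixedString_inverse (c d : Fin 2 × Fin 2) : ∃ R : Op, R * mixedString c d = 1 := by
  refine ⟨zString d * xString c, ?_⟩
  rw [mixedString, Matrix.mul_assoc, ← Matrix.mul_assoc (xString c), xString_mul_xString,
    bits_add_self, xString_zero, Matrix.one_mul, zString_mul_zString, bits_add_self, zString_zero]

/-- σ_y = i σ_x σ_z on each wire, and i² = -1. -/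
theorem spinFlip_eq : spinFlip = -mixedString (1, 1) (1, 1) := by
  ext ⟨a, b⟩ ⟨c, d⟩
  rw [mixedString, Matrix.neg_apply, xString_mul_apply, zString]
  fin_cases a <;> fin_cases b <;> fin_cases c <;> fin_cases d <;>
    simp [spinFlip_apply, pauli, bitSign, dotBits]

/-! ### Rotations generated by pure strings -/

/-- The rotation generated by a Pauli string. -/
noncomputable def stringRotation (p : Bool × (Fin 2 × Fin 2)) (θ : ℝ) : Op :=
  (Real.cos (θ / 2) : ℂ) • 1 - (Complex.I * (Real.sin (θ / 2) : ℂ)) • pauliString p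

theorem stringRotation_zero (p : Bool × (Fin 2 × Fin 2)) : stringRotation p 0 = 1 := by
  simp [stringRotation]

theorem stringRotation_neg (p : Bool × (Fin 2 × Fin 2)) (θ : ℝ) : stringRotation p (-θ) =
    (Real.cos (θ / 2) : ℂ) • 1 + (Complex.I * (Real.sin (θ / 2) : ℂ)) • pauliString p := by
  rw [stringRotation, neg_div, Real.cos_neg, Real.sin_neg, Complex.ofReal_neg, mul_neg, neg_smul,
    sub_neg_eq_add]

theorem stringRotation_neg_mul (p : Bool × (Fin 2 × Fin 2)) (θ : ℝ) :
    stringRotation p (-θ) * stringRotation p θ = 1 := by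
  have h : ((Real.cos (θ / 2) : ℝ) : ℂ) ^ 2 + (Real.sin (θ / 2) : ℂ) ^ 2 = 1 := by
    exact_mod_cast Real.cos_sq_add_sin_sq (θ / 2)
  rw [stringRotation_neg, stringRotation]
  generalize (Real.cos (θ / 2) : ℂ) = c at *
  generalize (Real.sin (θ / 2) : ℂ) = s at *
  simp only [Matrix.add_mul, Matrix.mul_sub, Matrix.smul_mul, Matrix.mul_smul, Matrix.one_mul,
    Matrix.mul_one, pauliString_mul_self]
  match_scalars
  · linear_combination h - s ^ 2 * Complex.I_sq
  · ring

/-- Pure strings are real matrices, so only the factor i changes sign. This is where the CXZ library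
is special: a rotation about y is itself real. -/
theorem map_star_stringRotation (p : Bool × (Fin 2 × Fin 2)) (θ : ℝ) :
    (stringRotation p θ).map star = stringRotation p (-θ) := by
  ext i j
  have h : star (pauliString p i j) = pauliString p i j :=
    congrFun (congrFun (map_star_pauliString p) i) j
  have h1 : star ((1 : Op) i j) = (1 : Op) i j := by
    rw [Matrix.one_apply]; split_ifs <;> simp
  rw [stringRotation_neg]
  simp only [stringRotation, Matrix.map_apply, Matrix.sub_apply, Matrix.add_apply,
    Matrix.smul_apply, smul_eq_mul, star_sub, star_mul', h, h1]
  simp [-Complex.ofReal_cos, -Complex.ofReal_sin]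

theorem transpose_stringRotation (p : Bool × (Fin 2 × Fin 2)) (θ : ℝ) :
    (stringRotation p θ)ᵀ = stringRotation p θ := by
  simp [stringRotation, transpose_pauliString]

theorem stringRotation_comm {p q : Bool × (Fin 2 × Fin 2)} (h : p.1 = q.1) (s t : ℝ) :
    stringRotation p s * stringRotation q t = stringRotation q t * stringRotation p s := by
  have h := pauliString_comm h
  simp only [stringRotation, Matrix.sub_mul, Matrix.mul_sub, Matrix.smul_mul, Matrix.mul_smul,
    Matrix.one_mul, Matrix.mul_one, h]
  module

theorem mixedString_mul_stringRotation {c d : Fin 2 × Fin 2} {p : Bool × (Fin 2 × Fin 2)}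
    (h : pairing c d p = 1) (θ : ℝ) :
    mixedString c d * stringRotation p θ = stringRotation p (-θ) * mixedString c d := by
  have hp := mixedString_mul_pauliString c d p
  rw [h, show bitSign 1 = -1 from rfl] at hp
  rw [stringRotation_neg, stringRotation, Matrix.mul_sub, Matrix.add_mul, Matrix.mul_smul,
    Matrix.mul_smul, hp, Matrix.smul_mul, Matrix.smul_mul, Matrix.mul_one, Matrix.one_mul]
  module

/-- A string rotation anticommuting with the spin flip is local, so it preserves the spin flip. -/
theorem stringRotation_mul_spinFlip {p : Bool × (Fin 2 × Fin 2)} (h : pairing (1, 1) (1, 1) p = 1)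
    (θ : ℝ) : stringRotation p θ * spinFlip * stringRotation p θ = spinFlip := by
  have h1 := mixedString_mul_stringRotation h (-θ)
  rw [neg_neg] at h1
  rw [spinFlip_eq, Matrix.mul_neg, ← h1, Matrix.neg_mul, Matrix.mul_assoc, stringRotation_neg_mul,
    Matrix.mul_one]

/-! ### The local invariant and its value on three rotations -/

/-- An invariant of two-qubit operators under local operators. -/
noncomputable def flipTrace (M : Op) : ℂ := (M * spinFlip * Mᵀ * spinFlip).trace

theorem flipTrace_local {L R : Op} (hL : L * spinFlip * Lᵀ = spinFlip)
    (hR : R * spinFlip * Rᵀ = spinFlip) (M : Op) : flipTrace (L * M * R) = flipTrace M := by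
  have h : L * M * R * spinFlip * (L * M * R)ᵀ * spinFlip =
      L * (M * (R * spinFlip * Rᵀ) * Mᵀ * Lᵀ * spinFlip) := by
    simp only [Matrix.transpose_mul, Matrix.mul_assoc]
  have h' : M * spinFlip * Mᵀ * Lᵀ * spinFlip * L = M * spinFlip * Mᵀ * spinFlip := by
    calc M * spinFlip * Mᵀ * Lᵀ * spinFlip * L = M * spinFlip * Mᵀ * (Lᵀ * spinFlip * L) := by
          simp only [Matrix.mul_assoc]
      _ = _ := by rw [transpose_mul_spinFlip hL]
  simp only [flipTrace]
  rw [h, hR, Matrix.trace_mul_comm, h']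

theorem flipTrace_smul (ζ : ℂ) (M : Op) : flipTrace (ζ • M) = ζ ^ 2 * flipTrace M := by
  simp only [flipTrace, Matrix.transpose_smul, Matrix.smul_mul, Matrix.mul_smul, smul_smul,
    Matrix.trace_smul, smul_eq_mul, sq]

theorem map_star_mul (A B : Op) : (A * B).map star = A.map star * B.map star :=
  Matrix.map_mul (f := starRingEnd ℂ)

theorem star_trace (A : Op) : star A.trace = (A.map star).trace := by
  simp [Matrix.trace]

theorem bits_real (c d : Fin 2 × Fin 2) : (mixedString c d).map star = mixedString c d := by
  have hx := map_star_pauliString (false, c)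
  have hz := map_star_pauliString (true, d)
  simp only [pauliString, if_true, Bool.false_eq_true, if_false] at hx hz
  rw [mixedString, map_star_mul, hx, hz]

/-- If a Pauli string turns `K` and its transpose into their complex conjugates, then the square
of the trace of `K W Kᵀ W'` is real for all Pauli strings `W` and `W'`. -/
theorem trace_sq_real {c d : Fin 2 × Fin 2} {K : Op}
    (h : mixedString c d * K = K.map star * mixedString c d)
    (h' : mixedString c d * Kᵀ = Kᵀ.map star * mixedString c d) (a b a' b' : Fin 2 × Fin 2) :
    star ((K * mixedString a b * Kᵀ * mixedString a' b').trace ^ 2) =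
      (K * mixedString a b * Kᵀ * mixedString a' b').trace ^ 2 := by
  obtain ⟨s, hs⟩ := mixedString_mul_mixedString c d a b
  obtain ⟨s', hs'⟩ := mixedString_mul_mixedString c d a' b'
  obtain ⟨R, hR⟩ := exists_mixedString_inverse c d
  have hR' : mixedString c d * R = 1 := mul_eq_one_comm.mp hR
  have hstar : star (K * mixedString a b * Kᵀ * mixedString a' b').trace =
      (K.map star * mixedString a b * Kᵀ.map star * mixedString a' b').trace := by
    rw [star_trace, map_star_mul, map_star_mul, map_star_mul, bits_real, bits_real]
  have hmul : mixedString c d * (K * mixedString a b * Kᵀ * mixedString a' b') =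
      (bitSign s * bitSign s') • ((K.map star * mixedString a b * Kᵀ.map star * mixedString a' b') *
        mixedString c d) := by
    calc mixedString c d * (K * mixedString a b * Kᵀ * mixedString a' b')
        = (mixedString c d * K) * mixedString a b * Kᵀ * mixedString a' b' := by
          simp only [Matrix.mul_assoc]
      _ = K.map star * (mixedString c d * mixedString a b) * Kᵀ * mixedString a' b' := by
          rw [h]; simp only [Matrix.mul_assoc]
      _ = bitSign s • (K.map star * mixedString a b * (mixedString c d * Kᵀ) *
            mixedString a' b') := by
          rw [hs]; simp only [Matrix.mul_assoc, Matrix.mul_smul, Matrix.smul_mul]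
      _ = bitSign s • (K.map star * mixedString a b * Kᵀ.map star *
            (mixedString c d * mixedString a' b')) := by
          rw [h']; simp only [Matrix.mul_assoc]
      _ = _ := by
          rw [hs']; simp only [Matrix.mul_assoc, Matrix.mul_smul, smul_smul]
  -- Conjugating inside the trace shows that it equals ± its complex conjugate: it is real or purely
  -- imaginary.
  have htr : (K * mixedString a b * Kᵀ * mixedString a' b').trace = (bitSign s * bitSign s') *
      star (K * mixedString a b * Kᵀ * mixedString a' b').trace := by
    rw [hstar]
    conv_lhs => rw [← Matrix.mul_one (K * mixedString a b * Kᵀ * mixedString a' b'), ← hR,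
      ← Matrix.mul_assoc, Matrix.trace_mul_comm, ← Matrix.mul_assoc, hmul, Matrix.smul_mul,
      Matrix.mul_assoc, hR', Matrix.mul_one, Matrix.trace_smul, smul_eq_mul]
  rw [star_pow]
  conv_rhs => rw [htr]
  rw [mul_pow, sq (bitSign s * bitSign s'), mul_mul_mul_comm, bitSign_mul_self, bitSign_mul_self]
  ring

/-- Three nontrivial strings of pure type either anticommute with a common Pauli string, or one of
the first two is local and commutes past the other, the rest having such a common string. -/
theorem exists_common_pairing : ∀ p q r : Bool × (Fin 2 × Fin 2), p.2 ≠ 0 → q.2 ≠ 0 → r.2 ≠ 0 →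
    (∃ c d, pairing c d p = 1 ∧ pairing c d q = 1 ∧ pairing c d r = 1) ∨
    (pairing (1, 1) (1, 1) p = 1 ∧ ∃ c d, pairing c d q = 1 ∧ pairing c d r = 1) ∨
    (p.1 = q.1 ∧ pairing (1, 1) (1, 1) q = 1 ∧ ∃ c d, pairing c d p = 1 ∧ pairing c d r = 1) := by
  -- Anticommutation gives three linear equations over 𝔽₂ for (c, d), each with right side 1. They
  -- are inconsistent only if p, q, r are the three nonzero strings of one type. Two of these are
  -- local, so p or q is; the three strings commute, and the two others are independent.
  set_option maxRecDepth 10000 in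
  decide

/-- `mixedString c d` conjugates `K` into its complex conjugate. -/
def Conjugates (c d : Fin 2 × Fin 2) (K : Op) : Prop :=
  mixedString c d * K = K.map star * mixedString c d

theorem Conjugates.mul {c d : Fin 2 × Fin 2} {K L : Op} (hK : Conjugates c d K)
    (hL : Conjugates c d L) : Conjugates c d (K * L) := by
  unfold Conjugates at *
  rw [← Matrix.mul_assoc, hK, Matrix.mul_assoc, hL, map_star_mul, Matrix.mul_assoc]

theorem conjugates_stringRotation {c d : Fin 2 × Fin 2} {p : Bool × (Fin 2 × Fin 2)}
    (h : pairing c d p = 1) (θ : ℝ) : Conjugates c d (stringRotation p θ) := by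
  rw [Conjugates, map_star_stringRotation, mixedString_mul_stringRotation h]

theorem trace_spinFlip_sq_real {c d : Fin 2 × Fin 2} {K : Op} (h : Conjugates c d K)
    (h' : Conjugates c d Kᵀ) (a b : Fin 2 × Fin 2) :
    star ((K * mixedString a b * Kᵀ * spinFlip).trace ^ 2) =
      (K * mixedString a b * Kᵀ * spinFlip).trace ^ 2 := by
  have := trace_sq_real h h' a b (1, 1) (1, 1)
  rw [spinFlip_eq, Matrix.mul_neg, Matrix.trace_neg, neg_sq]
  exact this

/-- Cyclicity brings the two outer rotations together around `spinFlip`, which they preserve. -/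
theorem trace_stringRotation_conj {p : Bool × (Fin 2 × Fin 2)} (h : pairing (1, 1) (1, 1) p = 1)
    (θ : ℝ) (M : Op) : (stringRotation p θ * M * stringRotation p θ * spinFlip).trace =
      (M * spinFlip).trace := by
  rw [Matrix.mul_assoc, Matrix.mul_assoc, Matrix.trace_mul_comm, Matrix.mul_assoc,
    stringRotation_mul_spinFlip h]

/-- With a common anticommuting string the previous reality statement applies to K directly, and to
its transpose, which is the reversed product. Otherwise a local rotation on the left, after a
commutation if necessary, disappears from the trace and two rotations remain. -/
theorem trace_three_rotations_sq_real {p q r : Bool × (Fin 2 × Fin 2)} (hp : p.2 ≠ 0) (hq : q.2 ≠ 0)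
    (hr : r.2 ≠ 0) (s t u : ℝ) (a b : Fin 2 × Fin 2) :
    star (((stringRotation p s * stringRotation q t * stringRotation r u) * mixedString a b *
      (stringRotation p s * stringRotation q t * stringRotation r u)ᵀ * spinFlip).trace ^ 2) =
    ((stringRotation p s * stringRotation q t * stringRotation r u) * mixedString a b *
      (stringRotation p s * stringRotation q t * stringRotation r u)ᵀ * spinFlip).trace ^ 2 := by
  have drop : ∀ {p q r : Bool × (Fin 2 × Fin 2)} (s t u : ℝ), pairing (1, 1) (1, 1) p = 1 →
      (∃ c d, pairing c d q = 1 ∧ pairing c d r = 1) →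
      star (((stringRotation p s * stringRotation q t * stringRotation r u) * mixedString a b *
        (stringRotation p s * stringRotation q t * stringRotation r u)ᵀ * spinFlip).trace ^ 2) =
      ((stringRotation p s * stringRotation q t * stringRotation r u) * mixedString a b *
        (stringRotation p s * stringRotation q t * stringRotation r u)ᵀ * spinFlip).trace ^ 2 := by
    rintro p q r s t u h ⟨c, d, h₂, h₃⟩
    have key := trace_stringRotation_conj h s ((stringRotation q t * stringRotation r u) *
      mixedString a b * (stringRotation q t * stringRotation r u)ᵀ)
    have hK : (stringRotation p s * stringRotation q t * stringRotation r u) * mixedString a b *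
        (stringRotation p s * stringRotation q t * stringRotation r u)ᵀ * spinFlip =
        stringRotation p s * ((stringRotation q t * stringRotation r u) * mixedString a b *
          (stringRotation q t * stringRotation r u)ᵀ) * stringRotation p s * spinFlip := by
      simp only [Matrix.transpose_mul, transpose_stringRotation, Matrix.mul_assoc]
    rw [hK, key]
    refine trace_spinFlip_sq_real (c := c) (d := d)
      ((conjugates_stringRotation h₂ t).mul (conjugates_stringRotation h₃ u)) ?_ a b
    rw [Matrix.transpose_mul, transpose_stringRotation, transpose_stringRotation]
    exact (conjugates_stringRotation h₃ u).mul (conjugates_stringRotation h₂ t)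
  rcases exists_common_pairing p q r hp hq hr with ⟨c, d, h₁, h₂, h₃⟩ | ⟨h, hcd⟩ | ⟨hpq, h, hcd⟩
  · refine trace_spinFlip_sq_real (c := c) (d := d) (((conjugates_stringRotation h₁ s).mul
      (conjugates_stringRotation h₂ t)).mul (conjugates_stringRotation h₃ u)) ?_ a b
    rw [Matrix.transpose_mul, Matrix.transpose_mul, transpose_stringRotation,
      transpose_stringRotation, transpose_stringRotation]
    exact (conjugates_stringRotation h₃ u).mul ((conjugates_stringRotation h₂ t).mul
      (conjugates_stringRotation h₁ s))
  · exact drop s t u h hcd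
  · rw [stringRotation_comm hpq]
    exact drop t s u h hcd

/-! ### Moving the CNOTs of a CXZ circuit to one side -/

/-- Real orthogonal operators permuting the Pauli strings of each pure type. -/
structure PreservesStrings (G : Op) : Prop where
  orthogonal : G * Gᵀ = 1
  comm : ∀ p : Bool × (Fin 2 × Fin 2), p.2 ≠ 0 → ∃ a : Fin 2 × Fin 2, a ≠ 0 ∧
    G * pauliString p = pauliString (p.1, a) * G

theorem PreservesStrings.one : PreservesStrings 1 where
  orthogonal := by rw [Matrix.transpose_one, Matrix.mul_one]
  comm p hp := ⟨p.2, hp, by rw [Matrix.one_mul, Matrix.mul_one]⟩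

theorem PreservesStrings.mul {G H : Op} (hG : PreservesStrings G) (hH : PreservesStrings H) :
    PreservesStrings (G * H) where
  orthogonal := by
    rw [Matrix.transpose_mul, Matrix.mul_assoc, ← Matrix.mul_assoc H, hH.orthogonal, Matrix.one_mul,
      hG.orthogonal]
  comm p hp := by
    obtain ⟨a, ha, h⟩ := hH.comm p hp
    obtain ⟨b, hb, h'⟩ := hG.comm (p.1, a) ha
    exact ⟨b, hb, by rw [Matrix.mul_assoc, h, ← Matrix.mul_assoc, h', Matrix.mul_assoc]⟩

theorem mul_xString_apply (M : Op) (a i j : Fin 2 × Fin 2) :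
    (M * xString a) i j = M i (j + a) := by
  simp [xString, Matrix.mul_apply]

theorem PreservesStrings.cnot (c : Fin 2) : PreservesStrings (cnot c) where
  orthogonal := by rw [transpose_cnot, cnot_mul_self]
  comm := by
    rintro ⟨k, a⟩ ha
    -- CNOT is a linear map on bit pairs: it moves x strings by that map and z strings by its
    -- transpose.
    let a' : Fin 2 × Fin 2 := if (c = 0) = (k = true) then (a.1 + a.2, a.2) else (a.1, a.1 + a.2)
    refine ⟨a', ?_, ?_⟩
    · revert ha
      simp only [a']
      revert c k a
      decide
    · unfold pauliString
      ext i j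
      cases k
      · rw [if_neg (by simp), if_neg (by simp), mul_xString_apply, xString_mul_apply]
        simp only [TwoQubit.cnot, Matrix.of_apply]
        congr 1
        rw [eq_iff_iff]
        simp only [a']
        revert c a i j
        decide
      · rw [if_pos rfl, if_pos rfl, zString, zString, Matrix.mul_diagonal, Matrix.diagonal_mul]
        simp only [TwoQubit.cnot, Matrix.of_apply]
        by_cases h : i = if c = 0 then (j.1, j.1 + j.2) else (j.1 + j.2, j.2)
        · rw [if_pos h, one_mul, mul_one, h]
          congr 1
          simp only [a']
          clear h ha
          revert c a j
          decide
        · rw [if_neg h, zero_mul, mul_zero]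

theorem PreservesStrings.mul_stringRotation {G : Op} (hG : PreservesStrings G)
    {p : Bool × (Fin 2 × Fin 2)} (hp : p.2 ≠ 0) (θ : ℝ) :
    ∃ q : Bool × (Fin 2 × Fin 2), q.2 ≠ 0 ∧ G * stringRotation p θ = stringRotation q θ * G := by
  obtain ⟨a, ha, h⟩ := hG.comm p hp
  refine ⟨(p.1, a), ha, ?_⟩
  rw [stringRotation, stringRotation, Matrix.mul_sub, Matrix.sub_mul, Matrix.mul_smul,
    Matrix.mul_smul, h, Matrix.smul_mul, Matrix.smul_mul, Matrix.mul_one, Matrix.one_mul]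

/-- The CNOT part is thus absorbed: it only replaces the inner spin flip by another Pauli string,
which `trace_three_rotations_sq_real` allows. -/
theorem PreservesStrings.conj_spinFlip {G : Op} (hG : PreservesStrings G) :
    ∃ a b : Fin 2 × Fin 2, G * spinFlip * Gᵀ = -mixedString a b := by
  obtain ⟨a, -, ha⟩ := hG.comm (false, (1, 1)) (by decide)
  obtain ⟨b, -, hb⟩ := hG.comm (true, (1, 1)) (by decide)
  simp only [pauliString, if_true, Bool.false_eq_true, if_false] at ha hb
  refine ⟨a, b, ?_⟩
  rw [spinFlip_eq, Matrix.mul_neg, Matrix.neg_mul, mixedString, ← Matrix.mul_assoc, ha,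
    Matrix.mul_assoc (xString a), hb, Matrix.mul_assoc, Matrix.mul_assoc, hG.orthogonal,
    Matrix.mul_one, mixedString]

theorem onWire_rotation (n : Axis) (w : Fin 2) (t : ℝ) : onWire w (rotation n t) =
    (Real.cos (t / 2) : ℂ) • 1 - (Complex.I * (Real.sin (t / 2) : ℂ)) • onWire w (pauli n) := by
  unfold onWire
  rw [rotation]
  split_ifs
  · rw [sub_eq_add_neg, Matrix.add_kronecker, ← neg_smul, Matrix.smul_kronecker,
      Matrix.smul_kronecker, Matrix.one_kronecker_one, neg_smul, ← sub_eq_add_neg]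
  · rw [sub_eq_add_neg, Matrix.kronecker_add, ← neg_smul, Matrix.kronecker_smul,
      Matrix.kronecker_smul, Matrix.one_kronecker_one, neg_smul, ← sub_eq_add_neg]

theorem exists_onWire_eq_stringRotation {n : Axis} (hn : n ∈ ({.x, .z} : Set Axis)) (w : Fin 2)
    (θ : ℝ) : ∃ p : Bool × (Fin 2 × Fin 2), p.2 ≠ 0 ∧
      onWire w (rotation n θ) = stringRotation p θ := by
  have key : ∀ p, onWire w (pauli n) = pauliString p →
      onWire w (rotation n θ) = stringRotation p θ := by
    intro p h
    rw [stringRotation, ← h, onWire_rotation]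
  -- The pair (1 - w, w) is the indicator of wire w.
  have hw : ((1 - w, w) : Fin 2 × Fin 2) ≠ 0 := by clear key; revert w; decide
  rcases hn with rfl | rfl
  · refine ⟨(false, (1 - w, w)), hw, key _ ?_⟩
    ext ⟨a, b⟩ ⟨c, d⟩
    fin_cases w <;> fin_cases a <;> fin_cases b <;> fin_cases c <;> fin_cases d <;>
      simp [onWire, pauli, pauliString, xString]
  · refine ⟨(true, (1 - w, w)), hw, key _ ?_⟩
    ext ⟨a, b⟩ ⟨c, d⟩
    fin_cases w <;> fin_cases a <;> fin_cases b <;> fin_cases c <;> fin_cases d <;>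
      simp [onWire, pauli, pauliString, zString, bitSign, dotBits]

/-- Over CNOT, `R_x` and `R_z`, the CNOT gates of a circuit can be moved to its beginning. -/
theorem exists_normal_form (C : Circuit) (hC : Topology.InLibrary C.topology {.x, .z}) :
    ∃ l : List ((Bool × (Fin 2 × Fin 2)) × ℝ), l.length = C.topology.countP Placeholder.isRot ∧
      (∀ q ∈ l, q.1.2 ≠ 0) ∧ ∃ G, PreservesStrings G ∧
        Circuit.op C = (l.map fun q => stringRotation q.1 q.2).prod * G := by
  induction C with
  | nil => exact ⟨[], rfl, by simp, 1, PreservesStrings.one, by simp [Circuit.op]⟩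
  | cons g C ih =>
    obtain ⟨l, hl, hl0, G, hG, h⟩ := ih fun n w hn => hC n w (List.mem_cons_of_mem _ hn)
    rcases g with c | ⟨n, w, θ⟩
    · refine ⟨l, ?_, hl0, G * cnot c, hG.mul (PreservesStrings.cnot c), ?_⟩
      · rw [hl]
        simp [Circuit.topology, Gate.placeholder, Placeholder.isRot]
      · rw [Circuit.op, h, Gate.op, Matrix.mul_assoc]
    · obtain ⟨p, hp, hp'⟩ := exists_onWire_eq_stringRotation
        (hC n w (by simp [Circuit.topology, Gate.placeholder])) w θ
      obtain ⟨q, hq, hq'⟩ := hG.mul_stringRotation hp θ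
      refine ⟨l ++ [(q, θ)], ?_, ?_, G, hG, ?_⟩
      · rw [List.length_append, hl]
        simp only [Circuit.topology, List.map_cons, Gate.placeholder]
        rw [List.countP_cons_of_pos rfl, List.length_singleton]
      · intro r hr
        rcases List.mem_append.mp hr with hr | hr
        · exact hl0 r hr
        · rw [List.mem_singleton.mp hr]; exact hq
      · rw [Circuit.op, h, Gate.op, hp', Matrix.mul_assoc, hq', List.map_append, List.prod_append,
          ← Matrix.mul_assoc]
        simp

/-- Shorter lists are padded with rotations by angle 0; the filler string only has to be nonzero. -/
theorem exists_three_rotations (l : List ((Bool × (Fin 2 × Fin 2)) × ℝ)) (hl : l.length ≤ 3)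
    (hl0 : ∀ q ∈ l, q.1.2 ≠ 0) : ∃ (p q r : Bool × (Fin 2 × Fin 2)) (s t u : ℝ),
      p.2 ≠ 0 ∧ q.2 ≠ 0 ∧ r.2 ≠ 0 ∧ (l.map fun q => stringRotation q.1 q.2).prod =
        stringRotation p s * stringRotation q t * stringRotation r u := by
  have h0 : ((true, ((1, 1) : Fin 2 × Fin 2)) : Bool × (Fin 2 × Fin 2)).2 ≠ 0 := by decide
  match l, hl, hl0 with
  | [], _, _ => exact ⟨_, _, _, 0, 0, 0, h0, h0, h0, by simp [stringRotation_zero]⟩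
  | [a], _, h => exact ⟨_, _, _, a.2, 0, 0, h a (by simp), h0, h0, by simp [stringRotation_zero]⟩
  | [a, b], _, h =>
    exact ⟨_, _, _, a.2, b.2, 0, h a (by simp), h b (by simp), h0, by simp [stringRotation_zero]⟩
  | [a, b, c], _, h =>
    exact ⟨_, _, _, a.2, b.2, c.2, h a (by simp), h b (by simp), h c (by simp),
      by simp [Matrix.mul_assoc]⟩
  | _ :: _ :: _ :: _ :: _, hl, _ => simp only [List.length_cons] at hl; omega

theorem flipTrace_sq_real_of_countP_le (C : Circuit)
    (hC : Topology.InLibrary C.topology {.x, .z})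
    (h3 : C.topology.countP Placeholder.isRot ≤ 3) :
    star (flipTrace (Circuit.op C) ^ 2) = flipTrace (Circuit.op C) ^ 2 := by
  obtain ⟨l, hl, hl0, G, hG, h⟩ := exists_normal_form C hC
  obtain ⟨p, q, r, s, t, u, hp, hq, hr, hK⟩ := exists_three_rotations l (by omega) hl0
  obtain ⟨a, b, hab⟩ := hG.conj_spinFlip
  have key := trace_three_rotations_sq_real hp hq hr s t u a b
  rw [h, hK]
  generalize stringRotation p s * stringRotation q t * stringRotation r u = K at key
  have e : K * G * spinFlip * (K * G)ᵀ * spinFlip = -(K * mixedString a b * Kᵀ * spinFlip) := by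
    calc K * G * spinFlip * (K * G)ᵀ * spinFlip = K * (G * spinFlip * Gᵀ) * Kᵀ * spinFlip := by
          simp only [Matrix.transpose_mul, Matrix.mul_assoc]
      _ = _ := by
          rw [hab]
          simp only [Matrix.mul_neg, Matrix.neg_mul]
  simp only [flipTrace]
  rw [e, Matrix.trace_neg, neg_sq, key]

theorem spinFlip_preserved_of_rot (C : Circuit) (h : ∀ p ∈ C.topology, p.isRot) :
    Circuit.op C * spinFlip * (Circuit.op C)ᵀ = spinFlip := by
  induction C with
  | nil => simp [Circuit.op]
  | cons g C ih =>
    have ih := ih fun p hp => h p (List.mem_cons_of_mem _ hp)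
    have hg : g.op * spinFlip * g.opᵀ = spinFlip := by
      rcases g with c | ⟨n, w, θ⟩
      · simpa [Gate.placeholder, Placeholder.isRot] using
          h (.cnot c) (by simp [Circuit.topology, Gate.placeholder])
      · simp only [Gate.op]
        unfold onWire
        split_ifs
        · rw [kronecker_mul_spinFlip, det_rotation, Matrix.det_one, one_mul, one_smul]
        · rw [kronecker_mul_spinFlip, det_rotation, Matrix.det_one, one_mul, one_smul]
    calc Circuit.op (g :: C) * spinFlip * (Circuit.op (g :: C))ᵀ =
        Circuit.op C * (g.op * spinFlip * g.opᵀ) * (Circuit.op C)ᵀ := by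
          simp only [Circuit.op, Matrix.transpose_mul, Matrix.mul_assoc]
      _ = spinFlip := by rw [hg, ih]

theorem det_onWire_rotation (n : Axis) (w : Fin 2) (θ : ℝ) :
    (onWire w (rotation n θ)).det = 1 := by
  unfold onWire
  split_ifs <;> rw [Matrix.det_kronecker, det_rotation, Matrix.det_one] <;> simp

theorem det_circuit_sq (C : Circuit) : (Circuit.op C).det ^ 2 = 1 := by
  induction C with
  | nil => simp [Circuit.op]
  | cons g C ih =>
    rw [Circuit.op, Matrix.det_mul, mul_pow, ih, one_mul]
    rcases g with c | ⟨n, w, θ⟩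
    · rw [Gate.op, sq, ← Matrix.det_mul, cnot_mul_self, Matrix.det_one]
    · rw [Gate.op, det_onWire_rotation, one_pow]

/-- An operator simulated over CNOT, `R_x` and `R_z` with at most three inner rotations has an
invariant with real square. -/
theorem flipTrace_sq_real {C : Circuit} (hC : Topology.InLibrary C.topology {.x, .z})
    (h3 : Topology.AllButOutside C.topology 3) {U : SU4} (hU : C.Simulates U) :
    (flipTrace (U : Op) ^ 2).im = 0 := by
  obtain ⟨before, middle, after, hT, hb, ha, hm⟩ := h3
  obtain ⟨C', C₃, rfl, hC', rfl⟩ := List.map_eq_append_iff.mp hT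
  obtain ⟨C₁, C₂, rfl, rfl, rfl⟩ := List.map_eq_append_iff.mp hC'
  obtain ⟨ζ, hζ, h⟩ := hU
  have hdet := det_circuit_sq (C₁ ++ C₂ ++ C₃)
  -- The determinant of a circuit is ±1 and that of U is 1. Since `flipTrace` scales by ζ², its
  -- square changes only by this sign.
  have hζ4 : ζ ^ 4 = 1 ∨ ζ ^ 4 = -1 := by
    have hd := SU4_det U
    rw [h, Matrix.det_smul] at hd
    simp only [Fintype.card_prod, Fintype.card_fin] at hd
    refine mul_self_eq_one_iff.mp ?_
    linear_combination (ζ ^ 4 * (Circuit.op (C₁ ++ C₂ ++ C₃)).det + 1) * hd - ζ ^ 8 * hdet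
  have hreal := flipTrace_sq_real_of_countP_le C₂
    (fun n w hn => hC n w (by
      simp only [Circuit.topology, List.map_append, List.mem_append] at hn ⊢
      tauto)) hm
  have hf : flipTrace (U : Op) = ζ ^ 2 * flipTrace (Circuit.op C₂) := by
    rw [h, flipTrace_smul, Circuit.op_append, Circuit.op_append, ← Matrix.mul_assoc,
      flipTrace_local (spinFlip_preserved_of_rot C₃ ha) (spinFlip_preserved_of_rot C₁ hb)]
  have him := Complex.conj_eq_iff_im.mp hreal
  rw [hf, mul_pow, ← pow_mul]
  rcases hζ4 with hζ4 | hζ4 <;> rw [hζ4]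
  · simpa using him
  · simpa using him

/-! ### Propagation of zeros along orbits -/

/-- If a continuous function is analytic along the orbits of a one-parameter subgroup, then it
vanishes along the orbits of almost all its zeros. -/
theorem ae_eq_zero_on_orbit {G : Type*} [Group G] [TopologicalSpace G] [IsTopologicalGroup G]
    [SecondCountableTopology G] [MeasurableSpace G] [BorelSpace G] (μ : Measure G) [SFinite μ]
    [μ.IsMulLeftInvariant] {f : G → ℝ} (hf : Continuous f) {φ : ℝ → G} (hφ : Continuous φ)
    (hadd : ∀ s t, φ (s + t) = φ s * φ t)
    (han : ∀ V, AnalyticOnNhd ℝ (fun t => f (φ t * V)) Set.univ) :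
    ∀ᵐ U ∂μ, f U = 0 → ∀ t, f (φ t * U) = 0 := by
  -- The bad set: zeros of f whose orbit contains a point where f does not vanish.
  let N : Set G := {U | f U = 0} ∩ ⋃ t, {U | f (φ t * U) ≠ 0}
  have hN : MeasurableSet N := by
    refine (isClosed_eq hf continuous_const).measurableSet.inter (IsOpen.measurableSet ?_)
    exact isOpen_iUnion fun t => isOpen_ne_fun (hf.comp (continuous_const_mul _)) continuous_const
  have hS : MeasurableSet {z : G × ℝ | φ z.2 * z.1 ∉ N} := by
    have hm : Measurable fun z : G × ℝ => φ z.2 * z.1 :=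
      ((hφ.comp continuous_snd).mul continuous_fst).measurable
    exact (hm hN).compl
  -- An orbit meeting N carries a nonzero analytic function of time, whose zeros are isolated and
  -- hence null. Fubini then yields a single time t with φ t * U outside N for almost all U, and
  -- left invariance removes φ t.
  have h1 : ∀ᵐ U ∂μ, ∀ᵐ t : ℝ, φ t * U ∉ N := by
    refine Filter.Eventually.of_forall fun U => ?_
    by_cases hU : ∃ t, φ t * U ∈ N
    · obtain ⟨t, -, ht⟩ := hU
      obtain ⟨s, hs⟩ := Set.mem_iUnion.mp ht
      have hne : f (φ (s + t) * U) ≠ 0 := by rw [hadd, mul_assoc]; exact hs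
      have hcod := (han U).preimage_zero_mem_codiscrete (x := s + t) hne
      have hae :=
        ae_restrict_le_codiscreteWithin (μ := (volume : Measure ℝ)) MeasurableSet.univ hcod
      rw [Measure.restrict_univ] at hae
      filter_upwards [hae] with r hr hrN
      exact hr hrN.1
    · exact Filter.Eventually.of_forall fun t ht => hU ⟨t, ht⟩
  obtain ⟨t, ht⟩ := ((Measure.ae_ae_comm (p := fun U t => φ t * U ∉ N) hS).mp h1).exists
  have h2 : ∀ᵐ U ∂μ, U ∉ N := (eventually_mul_left_iff μ (φ t)).mp ht
  filter_upwards [h2] with U hU h0 t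
  by_contra h
  exact hU ⟨h0, Set.mem_iUnion.mpr ⟨t, h⟩⟩

/-- The invariant whose vanishing is forced by having few inner rotations. -/
noncomputable def obstruction (M : Op) : ℝ := (flipTrace M ^ 2).im

theorem continuous_flipTrace : Continuous flipTrace := by
  unfold flipTrace
  generalize spinFlip = S
  exact (((continuous_id.matrix_mul continuous_const).matrix_mul
    continuous_id.matrix_transpose).matrix_mul continuous_const).matrix_trace

theorem continuous_obstruction : Continuous obstruction :=
  Complex.continuous_im.comp (continuous_flipTrace.pow 2)

theorem flipTrace_combination (c s : ℂ) (X Y : Op) : flipTrace (c • X - s • Y) =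
    c ^ 2 * flipTrace X - c * s * ((X * spinFlip * Yᵀ * spinFlip).trace +
      (Y * spinFlip * Xᵀ * spinFlip).trace) + s ^ 2 * flipTrace Y := by
  simp only [flipTrace, Matrix.transpose_sub, Matrix.transpose_smul, Matrix.sub_mul, Matrix.mul_sub,
    Matrix.smul_mul, Matrix.mul_smul, Matrix.trace_sub, Matrix.trace_smul, smul_eq_mul]
  ring

theorem analyticOnNhd_obstruction (X Y : Op) : AnalyticOnNhd ℝ (fun t : ℝ => obstruction
    ((Real.cos (t / 2) : ℂ) • X - (Complex.I * (Real.sin (t / 2) : ℂ)) • Y)) Set.univ := by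
  intro t _
  have hc : AnalyticAt ℝ (fun t : ℝ => (Real.cos (t / 2) : ℂ)) t :=
    (Complex.ofRealCLM.analyticAt _).comp
      (AnalyticAt.comp (g := Real.cos) Real.analyticAt_cos (by fun_prop))
  have hs : AnalyticAt ℝ (fun t : ℝ => Complex.I * (Real.sin (t / 2) : ℂ)) t :=
    analyticAt_const.mul ((Complex.ofRealCLM.analyticAt _).comp
      (AnalyticAt.comp (g := Real.sin) Real.analyticAt_sin (by fun_prop)))
  refine (Complex.imCLM.analyticAt _).comp (AnalyticAt.pow ?_ 2)
  simp only [flipTrace_combination]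
  exact (((hc.pow 2).mul analyticAt_const).sub ((hc.mul hs).mul analyticAt_const)).add
    ((hs.pow 2).mul analyticAt_const)

/-! ### Words in one-parameter subgroups -/

/-- The one-parameter subgroups generated by an involution. -/
structure IsOneParameter (φ : ℝ → SU4) : Prop where
  add : ∀ s t, φ (s + t) = φ s * φ t
  generator : ∃ J : Op, ∀ t, (φ t : Op) =
    (Real.cos (t / 2) : ℂ) • 1 - (Complex.I * (Real.sin (t / 2) : ℂ)) • J

theorem IsOneParameter.continuous {φ : ℝ → SU4} (h : IsOneParameter φ) : Continuous φ := by
  obtain ⟨J, hJ⟩ := h.generator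
  refine continuous_induced_rng.mpr ?_
  have : (Subtype.val ∘ φ) = fun t : ℝ =>
      (Real.cos (t / 2) : ℂ) • (1 : Op) - (Complex.I * (Real.sin (t / 2) : ℂ)) • J := funext hJ
  rw [this]
  fun_prop

/-- The products of elements of the given one-parameter subgroups. -/
def words : List (ℝ → SU4) → Set SU4
  | [] => {1}
  | φ :: l => {g | ∃ t, ∃ h ∈ words l, g = φ t * h}

theorem mul_mem_words {l l' : List (ℝ → SU4)} {g h : SU4} (hg : g ∈ words l) (hh : h ∈ words l') :
    g * h ∈ words (l ++ l') := by
  induction l generalizing g with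
  | nil =>
    rw [Set.mem_singleton_iff.mp hg, one_mul]
    exact hh
  | cons φ l ih =>
    obtain ⟨t, g', hg', rfl⟩ := hg
    exact ⟨t, g' * h, ih hg', mul_assoc _ _ _⟩

instance : SecondCountableTopology Op :=
  inferInstanceAs (SecondCountableTopology (Fin 2 × Fin 2 → Fin 2 × Fin 2 → ℂ))

instance : SecondCountableTopology SU4 := TopologicalSpace.Subtype.secondCountableTopology _

instance : haarSU4.IsMulLeftInvariant :=
  inferInstanceAs (Measure.haar (G := SU4)).IsMulLeftInvariant

instance : IsFiniteMeasureOnCompacts haarSU4 :=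
  inferInstanceAs (IsFiniteMeasureOnCompacts (Measure.haar (G := SU4)))

/-- Vanishing spreads along the first subgroup by `ae_eq_zero_on_orbit`, then along the rest by
induction. The prefix `A` is arbitrary so that the induction hypothesis applies to `A * φ q`. -/
theorem ae_obstruction_words (l : List (ℝ → SU4)) (hl : ∀ φ ∈ l, IsOneParameter φ) (A : SU4) :
    ∀ᵐ U ∂haarSU4, obstruction ((A * U : SU4) : Op) = 0 →
      ∀ g ∈ words l, obstruction ((A * g * U : SU4) : Op) = 0 := by
  induction l generalizing A with
  | nil =>
    refine Filter.Eventually.of_forall fun U h g hg => ?_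
    rw [Set.mem_singleton_iff.mp hg, mul_one]
    exact h
  | cons φ l ih =>
    have hφ := hl φ (by simp)
    have hl' : ∀ ψ ∈ l, IsOneParameter ψ := fun ψ hψ => hl ψ (List.mem_cons_of_mem _ hψ)
    have hcont : Continuous fun U : SU4 => obstruction ((A * U : SU4) : Op) :=
      continuous_obstruction.comp (continuous_subtype_val.comp (continuous_const_mul A))
    have h1 := ae_eq_zero_on_orbit haarSU4 hcont hφ.continuous hφ.add (fun V => by
      obtain ⟨J, hJ⟩ := hφ.generator
      have : (fun t => obstruction ((A * (φ t * V) : SU4) : Op)) = fun t : ℝ => obstruction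
          ((Real.cos (t / 2) : ℂ) • ((A : Op) * V) -
            (Complex.I * (Real.sin (t / 2) : ℂ)) • ((A : Op) * (J * V))) := by
        funext t
        congr 1
        calc ((A * (φ t * V) : SU4) : Op) = (A : Op) * ((φ t : Op) * V) := rfl
          _ = _ := by
            rw [hJ, Matrix.sub_mul, Matrix.smul_mul, Matrix.smul_mul, Matrix.one_mul,
              Matrix.mul_sub, Matrix.mul_smul, Matrix.mul_smul]
      rw [this]
      exact analyticOnNhd_obstruction _ _)
    -- The exceptional null set depends on the time, so only countably many times are used;
    -- continuity then reaches all real ones.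
    have h2 := ae_all_iff.mpr fun q : ℚ => ih hl' (A * φ q)
    filter_upwards [h1, h2] with U hU hU' h0 g hg
    obtain ⟨t, k, hk, rfl⟩ := hg
    have hc : Continuous fun t : ℝ => obstruction ((A * (φ t * k) * U : SU4) : Op) :=
      continuous_obstruction.comp (continuous_subtype_val.comp
        ((continuous_const.mul (hφ.continuous.mul continuous_const)).mul continuous_const))
    have heq := Rat.denseRange_cast (𝕜 := ℝ) |>.equalizer hc continuous_const (by
      funext q
      have := hU' q (by rw [mul_assoc]; exact hU h0 q) k hk
      rw [mul_assoc A] at this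
      exact this)
    exact congrFun heq t

/-! ### SU(4) as words in conjugated rotations -/

theorem onWire_mul_conjTranspose (w : Fin 2) {A : Matrix (Fin 2) (Fin 2) ℂ} (h : A * Aᴴ = 1) :
    onWire w A * (onWire w A)ᴴ = 1 := by
  have h' : (onWire w A)ᴴ = onWire w Aᴴ := by
    unfold onWire
    split_ifs <;> rw [Matrix.conjTranspose_kronecker, Matrix.conjTranspose_one]
  rw [h', ← onWire_mul, h]
  unfold onWire
  split_ifs <;> exact Matrix.one_kronecker_one

/-- The one-parameter subgroup obtained from a rotation gate by conjugation. -/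
noncomputable def conjRotation (G : Matrix.unitaryGroup (Fin 2 × Fin 2) ℂ) (n : Axis) (w : Fin 2)
    (t : ℝ) : SU4 :=
  ⟨(G : Op) * onWire w (rotation n t) * (G : Op)ᴴ, by
    have hG : (G : Op) * (G : Op)ᴴ = 1 := Matrix.mem_unitaryGroup_iff.mp G.2
    have hG' := mul_eq_one_comm.mp hG
    refine Matrix.mem_specialUnitaryGroup_iff.mpr ⟨Matrix.mem_unitaryGroup_iff.mpr ?_, ?_⟩
    · rw [Matrix.star_eq_conjTranspose]
      calc (G : Op) * onWire w (rotation n t) * (G : Op)ᴴ *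
            ((G : Op) * onWire w (rotation n t) * (G : Op)ᴴ)ᴴ =
          (G : Op) * (onWire w (rotation n t) * ((G : Op)ᴴ * G) * (onWire w (rotation n t))ᴴ) *
            (G : Op)ᴴ := by
            simp only [Matrix.conjTranspose_mul, Matrix.conjTranspose_conjTranspose,
              Matrix.mul_assoc]
        _ = 1 := by
            rw [hG', Matrix.mul_one, onWire_mul_conjTranspose w (rotation_mul_conjTranspose n t),
              Matrix.mul_one, hG]
    · rw [Matrix.det_mul, Matrix.det_mul, det_onWire_rotation, mul_one, ← Matrix.det_mul, hG,
        Matrix.det_one]⟩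

theorem isOneParameter_conjRotation (G : Matrix.unitaryGroup (Fin 2 × Fin 2) ℂ) (n : Axis)
    (w : Fin 2) : IsOneParameter (conjRotation G n w) where
  add s t := by
    have hG' : (G : Op)ᴴ * (G : Op) = 1 := mul_eq_one_comm.mp (Matrix.mem_unitaryGroup_iff.mp G.2)
    apply Subtype.ext
    calc (G : Op) * onWire w (rotation n (s + t)) * (G : Op)ᴴ =
        (G : Op) * onWire w (rotation n s) * ((G : Op)ᴴ * G) * onWire w (rotation n t) *
          (G : Op)ᴴ := by
          rw [rotation_add, onWire_mul, hG', Matrix.mul_one]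
          simp only [Matrix.mul_assoc]
      _ = (G : Op) * onWire w (rotation n s) * (G : Op)ᴴ *
          ((G : Op) * onWire w (rotation n t) * (G : Op)ᴴ) := by
          simp only [Matrix.mul_assoc]
  generator := by
    refine ⟨(G : Op) * onWire w (pauli n) * (G : Op)ᴴ, fun t => ?_⟩
    change (G : Op) * onWire w (rotation n t) * (G : Op)ᴴ = _
    rw [onWire_rotation, Matrix.mul_sub, Matrix.sub_mul, Matrix.mul_smul, Matrix.mul_smul,
      Matrix.smul_mul, Matrix.smul_mul, Matrix.mul_one,
      show (G : Op) * (G : Op)ᴴ = 1 from Matrix.mem_unitaryGroup_iff.mp G.2]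

theorem conjTranspose_cnot (c : Fin 2) : (cnot c)ᴴ = cnot c := by
  rw [Matrix.conjTranspose, transpose_cnot]
  ext i j
  simp only [cnot, Matrix.map_apply, Matrix.of_apply, apply_ite star, star_one, star_zero]

theorem SU4_coe_mul (U V : SU4) : ((U * V : SU4) : Op) = (U : Op) * (V : Op) := rfl

/-- The CNOT gate as a unitary operator. -/
noncomputable def cnotUnitary (c : Fin 2) : Matrix.unitaryGroup (Fin 2 × Fin 2) ℂ :=
  ⟨cnot c, Matrix.mem_unitaryGroup_iff.mpr (by
    rw [Matrix.star_eq_conjTranspose, conjTranspose_cnot, cnot_mul_self])⟩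

/-- One-parameter subgroups whose products are the local operators. -/
noncomputable def localSubgroups : List (ℝ → SU4) :=
  [conjRotation 1 .z 0, conjRotation 1 .y 0, conjRotation 1 .z 0,
    conjRotation 1 .z 1, conjRotation 1 .y 1, conjRotation 1 .z 1]

/-- One-parameter subgroups whose products are the interactions. -/
noncomputable def interactionSubgroups : List (ℝ → SU4) :=
  [conjRotation (cnotUnitary 1) .z 0, conjRotation (cnotUnitary 1) .y 1,
    conjRotation (cnotUnitary 1 * cnotUnitary 0) .y 1]

theorem exists_word_local {A B : Matrix (Fin 2) (Fin 2) ℂ} (hA : A ∈ SU2) (hB : B ∈ SU2) :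
    ∃ g ∈ words localSubgroups, (g : Op) = A ⊗ₖ B := by
  obtain ⟨α, β, γ, rfl⟩ := exists_euler_angles hA
  obtain ⟨α', β', γ', rfl⟩ := exists_euler_angles hB
  refine ⟨_, ⟨α, _, ⟨β, _, ⟨γ, _, ⟨α', _, ⟨β', _, ⟨γ', 1, rfl, rfl⟩, rfl⟩, rfl⟩, rfl⟩, rfl⟩, rfl⟩,
    ?_⟩
  have h : ∀ n w t, ((conjRotation 1 n w t : SU4) : Op) = onWire w (rotation n t) := fun n w t => by
    simp [conjRotation]
  rw [← onWire_zero_mul_one]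
  simp only [onWire_mul, SU4_coe_mul, h, Matrix.mul_assoc, mul_one]

/-- A swap is three alternating CNOTs. With this identity the CNOTs of an interaction pair up into
conjugations, making it a product of three one-parameter elements. -/
theorem cnot_mul_swap : cnot 1 * swap = cnot 0 * cnot 1 := by
  ext ⟨a, b⟩ ⟨c, d⟩
  rw [cnot_one_mul_apply, cnot_zero_mul_apply]
  fin_cases a <;> fin_cases b <;> fin_cases c <;> fin_cases d <;> simp [cnot, swap]

theorem exists_word_interaction (a b c : ℝ) :
    ∃ g ∈ words interactionSubgroups, (g : Op) = interaction a b c := by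
  refine ⟨_, ⟨a, _, ⟨b, _, ⟨c, 1, rfl, rfl⟩, rfl⟩, rfl⟩, ?_⟩
  have h1 : ∀ n w t, ((conjRotation (cnotUnitary 1) n w t : SU4) : Op) =
      cnot 1 * onWire w (rotation n t) * cnot 1 := fun n w t => by
    simp [conjRotation, cnotUnitary, conjTranspose_cnot]
  have h2 : ∀ n w t, ((conjRotation (cnotUnitary 1 * cnotUnitary 0) n w t : SU4) : Op) =
      cnot 1 * (cnot 0 * onWire w (rotation n t) * cnot 0) * cnot 1 := fun n w t => by
    simp [conjRotation, cnotUnitary, conjTranspose_cnot, Matrix.mul_assoc]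
  have h3 : ∀ M : Op, cnot 1 * (cnot 1 * M) = M := fun M => by
    rw [← Matrix.mul_assoc, cnot_mul_self, Matrix.one_mul]
  rw [interaction, cnot_mul_swap, ← onWire_zero_mul_one, ← onWire_one, mul_one]
  simp only [SU4_coe_mul, h1, h2, Matrix.mul_assoc, h3]

/-- Every special unitary operator is a product of elements of these subgroups up to phase. -/
theorem exists_word (V : SU4) :
    ∃ g ∈ words (localSubgroups ++ (interactionSubgroups ++ localSubgroups)),
      ∃ ζ : ℂ, ζ ^ 4 = 1 ∧ (V : Op) = ζ • (g : Op) := by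
  obtain ⟨ζ, -, A, hA, B, hB, C, hC, D, hD, a, b, c, h⟩ :=
    exists_interaction (SU4_mul_conjTranspose V) (SU4_det V)
  obtain ⟨g₁, hg₁, h₁⟩ := exists_word_local hA hB
  obtain ⟨g₂, hg₂, h₂⟩ := exists_word_interaction a b c
  obtain ⟨g₃, hg₃, h₃⟩ := exists_word_local hC hD
  have hV : (V : Op) = ζ • ((g₁ * (g₂ * g₃) : SU4) : Op) := by
    rw [h, ← h₁, ← h₂, ← h₃, Matrix.mul_assoc]
    rfl
  refine ⟨g₁ * (g₂ * g₃), mul_mem_words hg₁ (mul_mem_words hg₂ hg₃), ζ, ?_, hV⟩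
  have hd := SU4_det V
  rw [hV, Matrix.det_smul, SU4_det, mul_one] at hd
  simpa using hd

/-! ### The obstruction is almost everywhere nonzero -/

theorem flipTrace_magic (e : Fin 2 × Fin 2 → ℂ) :
    flipTrace (magic * Matrix.diagonal e * magicᴴ) = ∑ k, e k ^ 2 := by
  have hs : spinFlip = -(magic * magicᵀ) := by rw [magic_mul_transpose, neg_neg]
  -- In the magic basis the spin-flip form is minus the standard one, so the invariant of a diagonal
  -- operator is the trace of its square.
  have hinv : magicᵀ * spinFlip * magic = -1 := by
    have h : magic * (-(magicᵀ * spinFlip)) = 1 := by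
      rw [Matrix.mul_neg, ← Matrix.mul_assoc, magic_mul_transpose, Matrix.neg_mul, neg_neg,
        spinFlip_mul_self]
    rw [← neg_eq_iff_eq_neg, ← Matrix.neg_mul]
    exact mul_eq_one_comm.mp h
  have key : magic * Matrix.diagonal e * magicᴴ * spinFlip *
      (magic * Matrix.diagonal e * magicᴴ)ᵀ = -(magic * (Matrix.diagonal e * Matrix.diagonal e) *
        magicᵀ) := by
    calc magic * Matrix.diagonal e * magicᴴ * spinFlip * (magic * Matrix.diagonal e * magicᴴ)ᵀ =
        -(magic * (Matrix.diagonal e * (magicᴴ * magic) * (magicᵀ * magicᴴᵀ) *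
          Matrix.diagonal e) * magicᵀ) := by
          rw [hs]
          simp only [Matrix.transpose_mul, Matrix.diagonal_transpose, Matrix.mul_assoc,
            Matrix.mul_neg, Matrix.neg_mul]
      _ = _ := by
          rw [conjTranspose_mul_magic, conjTranspose_transpose_mul _ conjTranspose_mul_magic,
            Matrix.mul_one, Matrix.mul_one]
  simp only [flipTrace]
  rw [key, Matrix.neg_mul, Matrix.trace_neg, Matrix.mul_assoc, Matrix.mul_assoc,
    Matrix.trace_mul_comm, Matrix.mul_assoc, hinv, Matrix.mul_neg, Matrix.mul_one,
    Matrix.trace_neg, neg_neg, Matrix.diagonal_mul_diagonal, Matrix.trace_diagonal]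
  simp only [sq]

theorem exists_obstruction_ne_zero : ∃ U : SU4, obstruction (U : Op) ≠ 0 := by
  let u : ℂ := Complex.exp ((Real.pi / 8 : ℝ) * Complex.I)
  have hu : ‖u‖ = 1 := Complex.norm_exp_ofReal_mul_I _
  have hu4 : u ^ 4 = Complex.I := by
    refine Eq.trans ?_ Complex.exp_pi_div_two_mul_I
    rw [← Complex.exp_nat_mul]
    congr 1
    push_cast
    ring
  have hu8 : u ^ 8 = -1 := by
    linear_combination (u ^ 4 + Complex.I) * hu4 + Complex.I_sq
  -- With u⁸ = -1 the entries u¹³, u, u, u have product u¹⁶ = 1, and their squares sum to -u² + 3u²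
  -- = 2u², whose square is 4u⁴ = 4i.
  let e : Fin 2 × Fin 2 → ℂ := fun k => if k = 0 then u ^ 13 else u
  have he : ∀ k, e k * star (e k) = 1 := fun k => mul_star_eq_one (by
    simp only [e]
    split_ifs <;> simp [hu])
  have hD : Matrix.diagonal e * (Matrix.diagonal e)ᴴ = 1 := by
    rw [Matrix.diagonal_conjTranspose, Matrix.diagonal_mul_diagonal, ← Matrix.diagonal_one]
    congr 1
    ext k
    exact he k
  refine ⟨⟨magic * Matrix.diagonal e * magicᴴ, Matrix.mem_specialUnitaryGroup_iff.mpr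
    ⟨Matrix.mem_unitaryGroup_iff.mpr ?_, ?_⟩⟩, ?_⟩
  · rw [Matrix.star_eq_conjTranspose]
    calc magic * Matrix.diagonal e * magicᴴ * (magic * Matrix.diagonal e * magicᴴ)ᴴ =
        magic * (Matrix.diagonal e * (magicᴴ * magic) * (Matrix.diagonal e)ᴴ) * magicᴴ := by
          simp only [Matrix.conjTranspose_mul, Matrix.conjTranspose_conjTranspose, Matrix.mul_assoc]
      _ = 1 := by
          rw [conjTranspose_mul_magic, Matrix.mul_one, hD, Matrix.mul_one, magic_mul_conjTranspose]
  · rw [Matrix.det_mul, Matrix.det_mul, mul_right_comm, det_magic_mul, one_mul, Matrix.det_diagonal,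
      Fintype.prod_prod_type]
    simp only [Fin.prod_univ_two, e, Prod.mk_eq_zero]
    simp
    linear_combination (u ^ 8 - 1) * hu8
  · have hsum : ∑ k, e k ^ 2 = 2 * u ^ 2 := by
      rw [Fintype.sum_prod_type]
      simp only [Fin.sum_univ_two, e, Prod.mk_eq_zero]
      simp
      linear_combination u ^ 2 * (u ^ 16 - u ^ 8 + 1) * hu8
    rw [obstruction, flipTrace_magic, hsum, show (2 * u ^ 2) ^ 2 = 4 * Complex.I by
      rw [← hu4]; ring]
    simp

/-- For almost every U, vanishing at U would spread to all words times U. These exhaust SU(4) up to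
phases with ζ⁴ = 1, which do not affect the obstruction, so it would vanish at `U₀` as well. -/
theorem ae_obstruction_ne_zero : ∀ᵐ U : SU4 ∂haarSU4, obstruction (U : Op) ≠ 0 := by
  obtain ⟨U₀, hU₀⟩ := exists_obstruction_ne_zero
  filter_upwards [ae_obstruction_words (localSubgroups ++ (interactionSubgroups ++ localSubgroups))
    (by
      intro φ hφ
      simp only [localSubgroups, interactionSubgroups, List.mem_append, List.mem_cons,
        List.not_mem_nil, or_false] at hφ
      rcases hφ with (rfl | rfl | rfl | rfl | rfl | rfl) | (rfl | rfl | rfl) |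
        (rfl | rfl | rfl | rfl | rfl | rfl) <;> exact isOneParameter_conjRotation _ _ _) 1]
    with U hU h0
  obtain ⟨g, hg, ζ, hζ, h⟩ := exists_word (U₀ * U⁻¹)
  have h1 := hU (by rwa [one_mul]) g hg
  rw [one_mul] at h1
  apply hU₀
  have h2 : (U₀ : Op) = ζ • ((g * U : SU4) : Op) := by
    calc (U₀ : Op) = ((U₀ * U⁻¹ * U : SU4) : Op) := by rw [inv_mul_cancel_right]
      _ = ((U₀ * U⁻¹ : SU4) : Op) * U := rfl
      _ = _ := by rw [h, Matrix.smul_mul]; rfl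
  rw [obstruction, h2, flipTrace_smul, mul_pow, ← pow_mul, hζ, one_mul]
  exact h1

end TwoQubit

theorem mainTheorem8 :
    (∀ᵐ U ∂TwoQubit.haarSU4, ∀ C : TwoQubit.Circuit,
      TwoQubit.Topology.InLibrary (TwoQubit.Circuit.topology C) {.x, .z} →
      TwoQubit.Topology.AllButOutside (TwoQubit.Circuit.topology C) 3 →
      ¬ TwoQubit.Circuit.Simulates C U) ∧
    (∃ T : TwoQubit.Topology, TwoQubit.Topology.InLibrary T {.y, .z} ∧
      TwoQubit.Topology.AllButOutside T 3 ∧ TwoQubit.Topology.IsUniversal T) ∧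
    (∃ T : TwoQubit.Topology, TwoQubit.Topology.InLibrary T {.x, .y} ∧
      TwoQubit.Topology.AllButOutside T 3 ∧ TwoQubit.Topology.IsUniversal T) := by
  refine ⟨?_, TwoQubit.exists_universal_yz, TwoQubit.exists_universal_xy⟩
  filter_upwards [TwoQubit.ae_obstruction_ne_zero] with U hU C hC h3 hS
  exact hU (TwoQubit.flipTrace_sq_real hC h3 hS)
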